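/- Diagrams and weights are taken over $\mathbb{C}$. A \emph{diagram} is a finite graph (loops and multiple edges allowed, not necessarily connected) all of whose vertices are trivalent or univalent, with a cyclic orientation at each trivalent vertex, and with at least one univalent vertex in each connected component. Let $\mathcal{B}$ be the complex vector space spanned by the isomorphism classes of diagrams modulo the AS- and IHX-relations, and for $n\ge 1$ let $\mathcal{B}^r_n\subset\mathcal{B}$ be the subspace spanned by the diagrams with $2n$ vertices that have at least one trivalent vertex in each connected component. For $N\ge 0$ let $e_{ij}$ ($1\le i,j\le N$) be the standard generators of $U(\mathfrak{gl}(N))$ and let $t(x,y)=\operatorname{tr}(xy)$. For a diagram $\Gamma$ with $u$ univalent vertices let $W_{\mathfrak{gl}(N)}(\Gamma)\in U(\mathfrak{gl}(N))$ be obtained by placing the tensor $t(x,[y,z])$ at each trivalent vertex (with $x,y,z$ in the cyclic order) and the tensor $\sum_{i,j} e_{ij}\otimes e_{ji}$ on each edge, contracting, and multiplying the $u$ resulting elements of $\mathfrak{gl}(N)$ at the univalent vertices in $U(\mathfrak{gl}(N))$, averaged over all $u!$ orders. This is the linear map $W_{\mathfrak{gl}(N)}$ on $\mathcal{B}$. The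 generalized Casimir elements are the central elements $c_j=\sum_{i_1,\dots,i_j=1}^N e_{i_1i_2}e_{i_2i_3}\cdots e_{i_ji_1}$ for $j\ge 1$, and $c_0=N$. We regard $N$ as a variable: $W_{\mathfrak{gl}}$ denotes the linear map $\Gamma\mapsto (W_{\mathfrak{gl}(N)}(\Gamma))_{N\ge 0}$ into $\prod_{N} U(\mathfrak{gl}(N))$. \textbf{Lemma.} Let $n\ge 1$, and let $p(n)$ be the number of partitions of $n$. (1) For every diagram $\Gamma$ with $2n$ vertices, $u$ of them univalent, and with a trivalent vertex in each connected component, there is a polynomial $P\in\mathbb{C}[c_0,c_1,c_2,\dots]$, independent of $N$, with $W_{\mathfrak{gl}(N)}(\Gamma)=P(c_0,c_1,\dots)$ for all $N$, such that each monomial $c_{j_1}\cdots c_{j_r}$ of $P$ (the variable $c_0$ included) satisfies $j_1+\dots+j_r\le \min(u,n)$ and $r\le n$; in particular only $c_0,\dots,c_u$ occur in $P$. (2) $\dim W_{\mathfrak{gl}}(\mathcal{B}^r_n)\le n^2p(n)$, and consequently $\dim W_{\mathfrak{gl}(N)}(\mathcal{B}^r_n)\le n^2p(n)$ for every single $N$.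 -/

import Mathlib

-- The commutator bracket on associative rings; in particular on the matrices `gl(N)`.
attribute [local instance 100] LieRing.ofAssociativeRing

/-! ## Uni-trivalent diagrams -/

/-- The flags (half-edges) of a diagram with `t` trivalent vertices and `u` univalent vertices:
`Sum.inl (v, i)` with `i = 0, 1, 2` are the three flags at the trivalent vertex `v`, in their
cyclic order `0 → 1 → 2 → 0`, and `Sum.inr l` is the only flag at the univalent vertex `l`. -/
abbrev HalfEdge (t u : ℕ) : Type := (Fin t × Fin 3) ⊕ Fin u

/-- The vertex at which a flag sits. -/
def HalfEdge.vertex {t u : ℕ} (h : HalfEdge t u) : Fin t ⊕ Fin u := Sum.map Prod.fst id h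

/-- The simple graph underlying a gluing of flags (loops and multiplicities are forgotten);
it is used only to speak about connected components. -/
def flagGraph {t u : ℕ} (edge : HalfEdge t u → HalfEdge t u) : SimpleGraph (Fin t ⊕ Fin u) :=
  SimpleGraph.fromRel fun p q => ∃ h, HalfEdge.vertex h = p ∧ HalfEdge.vertex (edge h) = q

/-- A diagram with `t` trivalent vertices, each with a cyclic orientation, and `u` univalent
vertices, all of them numbered: a fixed-point-free involution joins the flags to edges.
Loops and multiple edges are allowed, the diagram need not be connected, and each
connected component has at least one univalent vertex. -/
structure Diagram (t u : ℕ) where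
  edge : HalfEdge t u → HalfEdge t u
  edge_edge : ∀ h, edge (edge h) = h
  edge_ne : ∀ h, edge h ≠ h
  exists_leg : ∀ p, ∃ l : Fin u, (flagGraph edge).Reachable p (Sum.inr l)

/-- Each connected component contains at least one trivalent vertex. -/
def Diagram.HasTrivalent {t u : ℕ} (D : Diagram t u) : Prop :=
  ∀ p, ∃ v : Fin t, (flagGraph D.edge).Reachable p (Sum.inl v)

/-- The bijection of flags which renumbers the trivalent vertices by `π` and the univalent ones
by `ρ`, and permutes the flags at the trivalent vertex `v` by `s v`. -/
def flagRelabel {t u : ℕ} (π : Equiv.Perm (Fin t)) (s : Fin t → Equiv.Perm (Fin 3))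
    (ρ : Equiv.Perm (Fin u)) : Equiv.Perm (HalfEdge t u) :=
  Equiv.sumCongr (Equiv.prodShear π s) ρ

/-- The transposition of the flags `1` and `2` at the trivalent vertex `v`. -/
def flagFlip {t u : ℕ} (v : Fin t) : Equiv.Perm (HalfEdge t u) :=
  Equiv.swap (Sum.inl (v, 1)) (Sum.inl (v, 2))

/-- The cyclic permutation `(v, 1) → (v, 2) → (w, 1) → (v, 1)` of three flags. -/
def flagCycle {t u : ℕ} (v w : Fin t) : Equiv.Perm (HalfEdge t u) :=
  Equiv.swap (Sum.inl (v, 1)) (Sum.inl (v, 2)) * Equiv.swap (Sum.inl (v, 2)) (Sum.inl (w, 1))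

/-- All numbered diagrams. -/
abbrev AnyDiagram : Type := (t : ℕ) × (u : ℕ) × Diagram t u

/-- A diagram as a basis vector of the free vector space on all numbered diagrams. -/
noncomputable def Diagram.gen {t u : ℕ} (D : Diagram t u) : AnyDiagram →₀ ℂ :=
  Finsupp.single ⟨t, u, D⟩ 1

/-- The relations between diagrams.
* `iso`: isomorphic diagrams are equal. An isomorphism renumbers the vertices and acts on the three
  flags of a trivalent vertex by a rotation (an even permutation of `Fin 3`).
* `as`: reversing the cyclic orientation at one trivalent vertex `v` changes the sign.
* `ihx`: `v ≠ w` are trivalent vertices joined by an edge, namely by the flags `(v, 0)`, `(w, 0)`.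
  The four other strands arriving at `v` and `w`, say `x, y` at `v` and `z, r` at `w`, are
  distributed as `(x, y | z, r)`, `(z, x | y, r)` and `(y, z | x, r)`; the sum of the three diagrams
  vanishes. -/
inductive DiagramRel : (AnyDiagram →₀ ℂ) → Prop
  | iso {t u : ℕ} (D D' : Diagram t u) (π : Equiv.Perm (Fin t)) (s : Fin t → Equiv.Perm (Fin 3))
      (ρ : Equiv.Perm (Fin u)) (hs : ∀ v, Equiv.Perm.sign (s v) = 1)
      (h : ∀ x, D'.edge (flagRelabel π s ρ x) = flagRelabel π s ρ (D.edge x)) :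
      DiagramRel (D.gen - D'.gen)
  | as {t u : ℕ} (D D' : Diagram t u) (v : Fin t)
      (h : ∀ x, D'.edge (flagFlip v x) = flagFlip v (D.edge x)) :
      DiagramRel (D.gen + D'.gen)
  | ihx {t u : ℕ} (D₁ D₂ D₃ : Diagram t u) (v w : Fin t) (hvw : v ≠ w)
      (hedge : D₁.edge (Sum.inl (v, 0)) = Sum.inl (w, 0))
      (h₂ : ∀ x, D₂.edge (flagCycle v w x) = flagCycle v w (D₁.edge x))
      (h₃ : ∀ x, D₃.edge (flagCycle v w x) = flagCycle v w (D₂.edge x)) :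
      DiagramRel (D₁.gen + D₂.gen + D₃.gen)

/-- The subspace spanned by the relations. -/
noncomputable def diagramRelations : Submodule ℂ (AnyDiagram →₀ ℂ) :=
  Submodule.span ℂ {x | DiagramRel x}

/-- The space `𝓑` of diagrams modulo the AS- and IHX-relations. -/
abbrev DiagramSpace : Type := (AnyDiagram →₀ ℂ) ⧸ diagramRelations

/-- The class of a diagram in `𝓑`. -/
noncomputable def Diagram.cls {t u : ℕ} (D : Diagram t u) : DiagramSpace :=
  diagramRelations.mkQ D.gen

/-- The subspace `𝓑ʳₙ`, spanned by the diagrams of degree `n` (with `2 n` vertices) that have a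
trivalent vertex in every connected component. -/
noncomputable def reducedSpace (n : ℕ) : Submodule ℂ DiagramSpace :=
  Submodule.span ℂ
    {x | ∃ (t u : ℕ) (D : Diagram t u), t + u = 2 * n ∧ D.HasTrivalent ∧ x = D.cls}

/-! ## The universal enveloping algebra of `gl(N)` and the Casimir elements -/

/-- `U(gl(N))`, over the complex numbers. -/
abbrev GlU (N : ℕ) : Type := UniversalEnvelopingAlgebra ℂ (Matrix (Fin N) (Fin N) ℂ)

/-- The matrix unit `e_{ij}` for `p = (i, j)`. -/
def matUnit {N : ℕ} (p : Fin N × Fin N) : Matrix (Fin N) (Fin N) ℂ := Matrix.single p.1 p.2 1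

/-- The generator `e_{ij}` of `U(gl(N))` for `p = (i, j)`. -/
noncomputable def glGen {N : ℕ} (p : Fin N × Fin N) : GlU N :=
  UniversalEnvelopingAlgebra.ι ℂ (matUnit p)

/-- The matrix whose `(i, j)` entry is the element `e_{ij}` of `U(gl(N))`. -/
noncomputable def glGenMatrix (N : ℕ) : Matrix (Fin N) (Fin N) (GlU N) :=
  Matrix.of fun i j => glGen (i, j)

theorem glGen_comm {N : ℕ} (a b i j : Fin N) :
    glGen (a, b) * glGen (i, j) = glGen (i, j) * glGen (a, b) +
      ((if b = i then glGen (a, j) else 0) - (if j = a then glGen (i, b) else 0)) := by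
  have h := (UniversalEnvelopingAlgebra.ι ℂ (L := Matrix (Fin N) (Fin N) ℂ)).map_lie
    (matUnit (a, b)) (matUnit (i, j))
  rw [LieRing.of_associative_ring_bracket, LieRing.of_associative_ring_bracket] at h
  have e : matUnit (a, b) * matUnit (i, j) - matUnit (i, j) * matUnit (a, b) =
      (if b = i then matUnit (a, j) else 0) - (if j = a then matUnit (i, b) else 0) := by
    unfold matUnit
    congr 1
    · split_ifs with hb
      · subst hb; simp
      · simp [hb]
    · split_ifs with hb
      · subst hb; simp
      · simp [hb]
  rw [e, map_sub] at h
  have h' := sub_eq_iff_eq_add'.mp h.symm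
  unfold glGen
  rw [h']
  congr 2 <;> split_ifs <;> simp

theorem glGen_comm_pow {N : ℕ} (a b : Fin N) (k : ℕ) (i j : Fin N) :
    glGen (a, b) * (glGenMatrix N ^ k) i j = (glGenMatrix N ^ k) i j * glGen (a, b) +
      ((if b = i then (glGenMatrix N ^ k) a j else 0) -
        (if j = a then (glGenMatrix N ^ k) i b else 0)) := by
  induction k generalizing i j with
  | zero =>
    simp only [pow_zero, Matrix.one_apply]
    by_cases h1 : i = j <;> by_cases h2 : b = i <;> by_cases h3 : j = a <;> simp_all [eq_comm]
  | succ k ih =>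
    have hgen : ∀ p q, glGenMatrix N p q = glGen (p, q) := fun _ _ => rfl
    have key : ∀ m, glGen (a, b) * ((glGenMatrix N ^ k) i m * glGenMatrix N m j) =
        (glGenMatrix N ^ k) i m * glGenMatrix N m j * glGen (a, b) +
        ((if b = m then (glGenMatrix N ^ k) i b * glGen (a, j) else 0) -
          (if m = a then (glGenMatrix N ^ k) i b * glGen (a, j) else 0)) +
        ((if b = i then (glGenMatrix N ^ k) a m * glGenMatrix N m j else 0) -
          (if j = a then (glGenMatrix N ^ k) i m * glGenMatrix N m b else 0)) := by
      intro m
      rw [← mul_assoc, ih, add_mul, mul_assoc, hgen, glGen_comm, hgen]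
      simp only [sub_mul, mul_add, mul_sub, ite_mul, zero_mul, mul_ite, mul_zero, mul_assoc]
      split_ifs <;> subst_vars <;> abel
    simp only [pow_succ, Matrix.mul_apply, Finset.mul_sum, Finset.sum_mul]
    rw [Finset.sum_congr rfl fun m _ => key m]
    simp only [Finset.sum_add_distrib, Finset.sum_sub_distrib, Finset.sum_ite_eq,
      Finset.sum_ite_eq', Finset.mem_univ, if_true, sub_self, add_zero]
    congr 2 <;> split_ifs <;> simp

theorem casimir_mem_center (N j : ℕ) :
    Matrix.trace (glGenMatrix N ^ j) ∈ Subalgebra.center ℂ (GlU N) := by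
  have hgen : ∀ p : Fin N × Fin N, glGen p * Matrix.trace (glGenMatrix N ^ j) =
      Matrix.trace (glGenMatrix N ^ j) * glGen p := by
    rintro ⟨a, b⟩
    simp only [Matrix.trace, Matrix.diag, Finset.mul_sum, Finset.sum_mul, glGen_comm_pow,
      Finset.sum_add_distrib, Finset.sum_sub_distrib, Finset.sum_ite_eq,
      Finset.sum_ite_eq', Finset.mem_univ, if_true, sub_self, add_zero]
  have hι : ∀ x, UniversalEnvelopingAlgebra.ι ℂ x ∈
      Subalgebra.centralizer ℂ {Matrix.trace (glGenMatrix N ^ j)} := by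
    intro x
    rw [Matrix.matrix_eq_sum_single x, map_sum]
    refine Subalgebra.sum_mem _ fun a _ => ?_
    rw [map_sum]
    refine Subalgebra.sum_mem _ fun b _ => ?_
    have : Matrix.single a b (x a b) = x a b • matUnit (a, b) := by
      simp [matUnit, Matrix.smul_single]
    rw [this, map_smul]
    refine Subalgebra.smul_mem _ ?_ _
    rw [Subalgebra.mem_centralizer_iff]
    rintro y rfl
    exact (hgen (a, b)).symm
  let S := Subalgebra.centralizer ℂ {Matrix.trace (glGenMatrix N ^ j)}
  let φ : Matrix (Fin N) (Fin N) ℂ →ₗ⁅ℂ⁆ S :=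
    { toFun := fun x => ⟨UniversalEnvelopingAlgebra.ι ℂ x, hι x⟩
      map_add' := fun x y => Subtype.ext (map_add _ x y)
      map_smul' := fun c x => Subtype.ext (map_smul _ c x)
      map_lie' := fun {x y} => Subtype.ext
        ((UniversalEnvelopingAlgebra.ι ℂ).map_lie x y) }
  have hφ : S.val.comp (UniversalEnvelopingAlgebra.lift ℂ φ) = AlgHom.id ℂ (GlU N) := by
    refine UniversalEnvelopingAlgebra.hom_ext ℂ ?_
    ext x
    exact congrArg Subtype.val (UniversalEnvelopingAlgebra.lift_ι_apply ℂ φ x)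
  rw [Subalgebra.mem_center_iff]
  intro y
  have hy : y ∈ S := by
    have := DFunLike.congr_fun hφ y
    rw [← (show _ = y from this)]
    exact (UniversalEnvelopingAlgebra.lift ℂ φ y).2
  exact ((Subalgebra.mem_centralizer_iff ℂ).mp hy _ rfl).symm

/-- The generalized Casimir elements: `c_j = ∑ e_{i₁ i₂} e_{i₂ i₃} ⋯ e_{i_j i₁}`, that is the trace of
the `j`-th power of the matrix `(e_{ij})`; for `j = 0` this is `c_0 = N`.
They are elements of the center of `U(gl(N))`. -/
noncomputable def casimir (N j : ℕ) : Subalgebra.center ℂ (GlU N) :=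
  ⟨Matrix.trace (glGenMatrix N ^ j), casimir_mem_center N j⟩

/-! ## The `gl(N)` weight system -/

/-- The structure tensor `t(x, [y, z]) = tr (x [y, z])` on matrix units. -/
def structureTensor {N : ℕ} (p q r : Fin N × Fin N) : ℂ :=
  Matrix.trace (matUnit p * ⁅matUnit q, matUnit r⁆)

/-- The average over all orders of the product of `u` generators of `U(gl(N))`. -/
noncomputable def symWord {N u : ℕ} (a : Fin u → Fin N × Fin N) : GlU N :=
  ((u.factorial : ℂ)⁻¹) •
    ∑ π : Equiv.Perm (Fin u), (List.ofFn fun k => glGen (a (π k))).prod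

/-- The contribution of one labeling of the flags by matrix units: every trivalent vertex gives a
value of the structure tensor, and the legs, placed on the oriented circle in all possible
orders, give an averaged word in `U(gl(N))`. -/
noncomputable def labelWeight {N t u : ℕ} (l : HalfEdge t u → Fin N × Fin N) : GlU N :=
  (∏ v : Fin t, structureTensor (l (Sum.inl (v, 0))) (l (Sum.inl (v, 1))) (l (Sum.inl (v, 2)))) •
    symWord fun k => l (Sum.inr k)

/-- The labelings in which the two flags of every edge carry dual matrix units: `e_{ij}` and `e_{ji}`
are dual for the trace form `t(x, y) = tr (x y)`. -/
def Diagram.labelings {t u : ℕ} (D : Diagram t u) (N : ℕ) :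
    Finset (HalfEdge t u → Fin N × Fin N) :=
  Finset.univ.filter fun l => ∀ h, l (D.edge h) = (l h).swap

/-- The value of the `gl(N)` weight system on a diagram: the legs are attached to an oriented circle,
averaging over all orders, and the resulting diagram is evaluated in `U(gl(N))` by placing the
tensor `∑ e_{ij} ⊗ e_{ji}`, inverse to the trace form, on each edge and the structure tensor
on each trivalent vertex. -/
noncomputable def Diagram.weight {t u : ℕ} (D : Diagram t u) (N : ℕ) : GlU N :=
  ∑ l ∈ D.labelings N, labelWeight l

theorem Diagram.weight_of_conj {t u : ℕ} (D D' : Diagram t u) (N : ℕ)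
    (σ : Equiv.Perm (HalfEdge t u)) (h : ∀ x, D'.edge (σ x) = σ (D.edge x)) :
    D'.weight N = ∑ l ∈ D.labelings N, labelWeight (l ∘ σ.symm) := by
  unfold Diagram.weight
  refine (Finset.sum_bij' (fun l _ => l ∘ σ.symm) (fun l _ => l ∘ σ) ?_ ?_ ?_ ?_ ?_).symm
  · intro l hl
    simp only [Diagram.labelings, Finset.mem_filter, Finset.mem_univ, true_and] at hl ⊢
    intro x
    obtain ⟨y, rfl⟩ := σ.surjective x
    simp [h, hl]
  · intro l hl
    simp only [Diagram.labelings, Finset.mem_filter, Finset.mem_univ, true_and] at hl ⊢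
    intro x
    simp [← h, hl]
  · intro l _; ext1 x; simp
  · intro l _; ext1 x; simp
  · intro l _; rfl

theorem structureTensor_cyc {N : ℕ} (p q r : Fin N × Fin N) :
    structureTensor q r p = structureTensor p q r := by
  simp only [structureTensor, LieRing.of_associative_ring_bracket, mul_sub, Matrix.trace_sub]
  rw [← mul_assoc, ← mul_assoc, ← mul_assoc, ← mul_assoc, Matrix.trace_mul_cycle (matUnit q),
    Matrix.trace_mul_cycle (matUnit p) (matUnit r)]

theorem structureTensor_swap {N : ℕ} (p q r : Fin N × Fin N) :
    structureTensor p r q = -structureTensor p q r := by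
  simp only [structureTensor]
  rw [← lie_skew (matUnit q) (matUnit r), mul_neg, Matrix.trace_neg, neg_neg]

theorem structureTensor_perm {N : ℕ} (a : Fin 3 → Fin N × Fin N) (s : Equiv.Perm (Fin 3)) :
    structureTensor (a (s 0)) (a (s 1)) (a (s 2)) =
      ((Equiv.Perm.sign s : ℤ) : ℂ) * structureTensor (a 0) (a 1) (a 2) := by
  have hc := structureTensor_cyc (N := N)
  have hw := structureTensor_swap (N := N)
  have h : ∀ s : Equiv.Perm (Fin 3),
      (s 0 = 0 ∧ s 1 = 1 ∧ s 2 = 2 ∧ Equiv.Perm.sign s = 1) ∨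
      (s 0 = 1 ∧ s 1 = 2 ∧ s 2 = 0 ∧ Equiv.Perm.sign s = 1) ∨
      (s 0 = 2 ∧ s 1 = 0 ∧ s 2 = 1 ∧ Equiv.Perm.sign s = 1) ∨
      (s 0 = 0 ∧ s 1 = 2 ∧ s 2 = 1 ∧ Equiv.Perm.sign s = -1) ∨
      (s 0 = 1 ∧ s 1 = 0 ∧ s 2 = 2 ∧ Equiv.Perm.sign s = -1) ∨
      (s 0 = 2 ∧ s 1 = 1 ∧ s 2 = 0 ∧ Equiv.Perm.sign s = -1) := by decide
  rcases h s with h | h | h | h | h | h <;> obtain ⟨h0, h1, h2, h3⟩ := h <;>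
    rw [h0, h1, h2, h3]
  · simp
  · rw [hc (a 0) (a 1) (a 2)]; simp
  · rw [← hc (a 2) (a 0) (a 1)]; simp
  · rw [hw (a 0) (a 1) (a 2)]; simp
  · rw [hw (a 1) (a 2) (a 0), hc (a 0) (a 1) (a 2)]; simp
  · rw [hw (a 2) (a 0) (a 1), ← hc (a 2) (a 0) (a 1)]; simp

theorem symWord_perm {N u : ℕ} (a : Fin u → Fin N × Fin N) (ρ : Equiv.Perm (Fin u)) :
    symWord (fun k => a (ρ k)) = symWord a := by
  unfold symWord
  congr 1
  exact Fintype.sum_equiv (Equiv.mulLeft ρ) _ _ fun π => rfl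

theorem labelWeight_relabel {N t u : ℕ} (l : HalfEdge t u → Fin N × Fin N)
    (π : Equiv.Perm (Fin t)) (s : Fin t → Equiv.Perm (Fin 3)) (ρ : Equiv.Perm (Fin u)) :
    labelWeight (l ∘ flagRelabel π s ρ) =
      (∏ v, ((Equiv.Perm.sign (s v) : ℤ) : ℂ)) • labelWeight l := by
  unfold labelWeight
  have h1 : ∀ v k, (l ∘ flagRelabel π s ρ) (Sum.inl (v, k)) = l (Sum.inl (π v, s v k)) :=
    fun _ _ => rfl
  have h2 : ∀ k, (l ∘ flagRelabel π s ρ) (Sum.inr k) = l (Sum.inr (ρ k)) := fun _ => rfl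
  simp only [h1, h2]
  rw [symWord_perm (fun k => l (Sum.inr k)) ρ, smul_smul]
  congr 1
  rw [← Equiv.prod_comp π (fun v => structureTensor (l (Sum.inl (v, 0))) (l (Sum.inl (v, 1)))
    (l (Sum.inl (v, 2)))), ← Finset.prod_mul_distrib]
  exact Finset.prod_congr rfl fun v _ =>
    structureTensor_perm (fun k => l (Sum.inl (π v, k))) (s v)

theorem flagFlip_eq {t u : ℕ} (v : Fin t) :
    (flagFlip v : Equiv.Perm (HalfEdge t u)) =
      flagRelabel 1 (Function.update 1 v (Equiv.swap 1 2)) 1 := by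
  ext1 x
  rcases x with ⟨w, k⟩ | l
  · by_cases hw : w = v
    · subst hw
      fin_cases k <;>
        simp [flagFlip, flagRelabel, Equiv.swap_apply_def]
    · simp [flagFlip, flagRelabel, Equiv.swap_apply_def, hw]
  · simp [flagFlip, flagRelabel, Equiv.swap_apply_def]

/-- The contraction of two structure tensors along an edge. -/
theorem sum_structureTensor_mul {N : ℕ} (x y z r : Fin N × Fin N) :
    ∑ p : Fin N × Fin N, structureTensor p x y * structureTensor p.swap z r =
      Matrix.trace (⁅matUnit x, matUnit y⁆ * ⁅matUnit z, matUnit r⁆) := by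
  simp only [structureTensor, matUnit, Matrix.trace_single_mul, Fintype.sum_prod_type,
    Prod.fst_swap, Prod.snd_swap, one_mul, smul_eq_mul]
  rw [Finset.sum_comm]
  simp [Matrix.trace, Matrix.mul_apply]

theorem structureTensor_jacobi {N : ℕ} (x y z r : Fin N × Fin N) :
    ∑ p : Fin N × Fin N, (structureTensor p x y * structureTensor p.swap z r +
      structureTensor p z x * structureTensor p.swap y r +
      structureTensor p y z * structureTensor p.swap x r) = 0 := by
  simp only [Finset.sum_add_distrib, sum_structureTensor_mul]
  rw [← Matrix.trace_add, ← Matrix.trace_add]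
  simp only [LieRing.of_associative_ring_bracket]
  generalize matUnit x = X, matUnit y = Y, matUnit z = Z, matUnit r = R
  have e : (X * Y - Y * X) * (Z * R - R * Z) + (Z * X - X * Z) * (Y * R - R * Y) +
      (Y * Z - Z * Y) * (X * R - R * X) =
      (X * Y * Z - Y * X * Z + Z * X * Y - X * Z * Y + Y * Z * X - Z * Y * X) * R -
      ((X * Y * R * Z - Y * X * R * Z) + (Z * X * R * Y - X * Z * R * Y) +
      (Y * Z * R * X - Z * Y * R * X)) := by noncomm_ring
  rw [e]
  simp only [sub_mul, add_mul, Matrix.trace_sub, Matrix.trace_add]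
  rw [Matrix.trace_mul_comm (X * Y * R) Z, Matrix.trace_mul_comm (Y * X * R) Z,
    Matrix.trace_mul_comm (Z * X * R) Y, Matrix.trace_mul_comm (X * Z * R) Y,
    Matrix.trace_mul_comm (Y * Z * R) X, Matrix.trace_mul_comm (Z * Y * R) X]
  simp only [← mul_assoc]
  ring

/-- Change the labels of the two flags of the edge joining `(v, 0)` and `(w, 0)`. -/
def setEdgeLabel {N t u : ℕ} (v w : Fin t) (l : HalfEdge t u → Fin N × Fin N)
    (p : Fin N × Fin N) : HalfEdge t u → Fin N × Fin N :=
  Function.update (Function.update l (Sum.inl (v, 0)) p) (Sum.inl (w, 0)) p.swap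

theorem sum_labelWeight_edge {N t u : ℕ} (v w : Fin t) (hvw : v ≠ w)
    (l : HalfEdge t u → Fin N × Fin N) :
    ∑ p : Fin N × Fin N, (labelWeight (setEdgeLabel v w l p) +
      labelWeight (setEdgeLabel v w l p ∘ (flagCycle v w).symm) +
      labelWeight (setEdgeLabel v w l p ∘ (flagCycle v w).symm ∘ (flagCycle v w).symm)) = 0 := by
  classical
  set C : ℂ := ∏ k ∈ Finset.univ \ {v, w}, structureTensor (l (Sum.inl (k, 0)))
    (l (Sum.inl (k, 1))) (l (Sum.inl (k, 2))) with hC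
  have hwv := hvw.symm
  have split : ∀ m : HalfEdge t u → Fin N × Fin N,
      (∀ k, k ≠ v → k ≠ w → ∀ i, m (Sum.inl (k, i)) = l (Sum.inl (k, i))) →
      (∀ k, m (Sum.inr k) = l (Sum.inr k)) →
      labelWeight m = (C * (structureTensor (m (Sum.inl (v, 0))) (m (Sum.inl (v, 1)))
          (m (Sum.inl (v, 2))) * structureTensor (m (Sum.inl (w, 0))) (m (Sum.inl (w, 1)))
          (m (Sum.inl (w, 2))))) • symWord fun k => l (Sum.inr k) := by
    intro m h1 h2
    unfold labelWeight
    simp only [h2]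
    congr 1
    rw [← Finset.prod_sdiff (Finset.subset_univ {v, w}), Finset.prod_pair hvw, hC]
    congr 1
    refine Finset.prod_congr rfl fun k hk => ?_
    simp only [Finset.mem_sdiff, Finset.mem_insert, Finset.mem_singleton, not_or] at hk
    rw [h1 k hk.2.1 hk.2.2, h1 k hk.2.1 hk.2.2, h1 k hk.2.1 hk.2.2]
  have hcs : ∀ x, (flagCycle v w).symm x = Equiv.swap (Sum.inl (v, 2)) (Sum.inl (w, 1))
      (Equiv.swap (Sum.inl (v, 1)) (Sum.inl (v, 2)) x : HalfEdge t u) := fun _ => rfl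
  have key : ∀ p : Fin N × Fin N, labelWeight (setEdgeLabel v w l p) +
      labelWeight (setEdgeLabel v w l p ∘ (flagCycle v w).symm) +
      labelWeight (setEdgeLabel v w l p ∘ (flagCycle v w).symm ∘ (flagCycle v w).symm) =
      (structureTensor p (l (Sum.inl (v, 1))) (l (Sum.inl (v, 2))) *
        structureTensor p.swap (l (Sum.inl (w, 1))) (l (Sum.inl (w, 2))) +
      structureTensor p (l (Sum.inl (w, 1))) (l (Sum.inl (v, 1))) *
        structureTensor p.swap (l (Sum.inl (v, 2))) (l (Sum.inl (w, 2))) +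
      structureTensor p (l (Sum.inl (v, 2))) (l (Sum.inl (w, 1))) *
        structureTensor p.swap (l (Sum.inl (v, 1))) (l (Sum.inl (w, 2)))) •
        (C • symWord fun k => l (Sum.inr k)) := by
    intro p
    rw [split (setEdgeLabel v w l p), split (_ ∘ (flagCycle v w).symm),
      split (_ ∘ _ ∘ (flagCycle v w).symm)]
    · simp [hcs, setEdgeLabel, Equiv.swap_apply_def, hvw, hwv]
      rw [smul_smul, ← add_smul, ← add_smul]
      congr 1
      ring
    all_goals
      intros
      simp [setEdgeLabel, Equiv.swap_apply_def, *]
  rw [Finset.sum_congr rfl fun p _ => key p, ← Finset.sum_smul, structureTensor_jacobi, zero_smul]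

theorem Diagram.weight_ihx {N t u : ℕ} (D : Diagram t u) (v w : Fin t) (hvw : v ≠ w)
    (hedge : D.edge (Sum.inl (v, 0)) = Sum.inl (w, 0)) :
    ∑ l ∈ D.labelings N, (labelWeight l + labelWeight (l ∘ (flagCycle v w).symm) +
      labelWeight (l ∘ (flagCycle v w).symm ∘ (flagCycle v w).symm)) = 0 := by
  classical
  set G : (HalfEdge t u → Fin N × Fin N) → GlU N := fun l =>
    labelWeight l + labelWeight (l ∘ (flagCycle v w).symm) +
      labelWeight (l ∘ (flagCycle v w).symm ∘ (flagCycle v w).symm) with hG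
  have hedge' : D.edge (Sum.inl (w, 0)) = Sum.inl (v, 0) := by rw [← hedge, D.edge_edge]
  have hmem : ∀ l, l ∈ D.labelings N ↔ ∀ h, l (D.edge h) = (l h).swap := by
    intro l; simp [Diagram.labelings]
  have hset : ∀ l ∈ D.labelings N, ∀ p, setEdgeLabel v w l p ∈ D.labelings N := by
    intro l hl p
    rw [hmem] at hl ⊢
    intro h
    by_cases h1 : h = Sum.inl (v, 0)
    · subst h1
      rw [hedge]
      simp [setEdgeLabel, hvw]
    by_cases h2 : h = Sum.inl (w, 0)
    · subst h2
      rw [hedge']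
      simp [setEdgeLabel, hvw]
    have h3 : D.edge h ≠ Sum.inl (v, 0) := fun e => h2 (by rw [← hedge, ← e, D.edge_edge])
    have h4 : D.edge h ≠ Sum.inl (w, 0) := fun e => h1 (by rw [← hedge', ← e, D.edge_edge])
    simp [setEdgeLabel, h1, h2, h3, h4, hl]
  have hback : ∀ l ∈ D.labelings N, ∀ p,
      setEdgeLabel v w (setEdgeLabel v w l p) (l (Sum.inl (v, 0))) = l := by
    intro l hl p
    rw [hmem] at hl
    have := hl (Sum.inl (v, 0))
    rw [hedge] at this
    ext1 x
    simp only [setEdgeLabel, Function.update_apply]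
    split_ifs with h1 h2
    · rw [h1, this]
    · rw [h2]
    · rfl
  have hval : ∀ (l : HalfEdge t u → Fin N × Fin N) p, setEdgeLabel v w l p (Sum.inl (v, 0)) = p := by
    intro l p
    simp [setEdgeLabel, hvw]
  have h1 : ∑ x ∈ D.labelings N ×ˢ (Finset.univ : Finset (Fin N × Fin N)),
      G (setEdgeLabel v w x.1 x.2) =
      ∑ x ∈ D.labelings N ×ˢ (Finset.univ : Finset (Fin N × Fin N)), G x.1 := by
    refine Finset.sum_bij' (fun x _ => (setEdgeLabel v w x.1 x.2, x.1 (Sum.inl (v, 0))))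
      (fun x _ => (setEdgeLabel v w x.1 x.2, x.1 (Sum.inl (v, 0)))) ?_ ?_ ?_ ?_ ?_
    · intro x hx
      simp only [Finset.mem_product, Finset.mem_univ, and_true] at hx ⊢
      exact hset _ hx _
    · intro x hx
      simp only [Finset.mem_product, Finset.mem_univ, and_true] at hx ⊢
      exact hset _ hx _
    · intro x hx
      simp only [Finset.mem_product, Finset.mem_univ, and_true] at hx
      exact Prod.ext (hback _ hx _) (hval _ _)
    · intro x hx
      simp only [Finset.mem_product, Finset.mem_univ, and_true] at hx
      exact Prod.ext (hback _ hx _) (hval _ _)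
    · intro x _; rfl
  rw [Finset.sum_product, Finset.sum_product,
    Finset.sum_eq_zero fun l _ => sum_labelWeight_edge v w hvw l] at h1
  simp only [Finset.sum_const, Finset.card_univ, ← Finset.smul_sum] at h1
  rcases Nat.eq_zero_or_pos N with h0 | h0
  · refine Finset.sum_eq_zero fun l _ => ?_
    subst h0
    exact (l (Sum.inl (v, 0))).1.elim0
  · rw [← Nat.cast_smul_eq_nsmul ℂ] at h1
    refine (smul_eq_zero.mp h1.symm).resolve_left ?_
    simp only [Fintype.card_prod, Fintype.card_fin]
    exact_mod_cast (Nat.mul_pos h0 h0).ne'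

/-- The linear extension of `Diagram.weight` to the free vector space. -/
noncomputable def freeWeight (N : ℕ) : (AnyDiagram →₀ ℂ) →ₗ[ℂ] GlU N :=
  Finsupp.lsum ℂ fun D => LinearMap.toSpanSingleton ℂ (GlU N) (D.2.2.weight N)

theorem freeWeight_gen {t u : ℕ} (D : Diagram t u) (N : ℕ) :
    freeWeight N D.gen = D.weight N := by
  simp [freeWeight, Diagram.gen]

theorem diagramRelations_le_ker (N : ℕ) :
    diagramRelations ≤ LinearMap.ker (freeWeight N) := by
  refine Submodule.span_le.mpr ?_
  rintro x hx
  rw [SetLike.mem_coe, LinearMap.mem_ker]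
  have hrel : ∀ {t u : ℕ} (D D' : Diagram t u) (π : Equiv.Perm (Fin t))
      (s : Fin t → Equiv.Perm (Fin 3)) (ρ : Equiv.Perm (Fin u)),
      (∀ x, D'.edge (flagRelabel π s ρ x) = flagRelabel π s ρ (D.edge x)) →
      D.weight N = (∏ v, ((Equiv.Perm.sign (s v) : ℤ) : ℂ)) • D'.weight N := by
    intro t u D D' π s ρ h
    rw [D.weight_of_conj D' N _ h, Finset.smul_sum]
    refine Finset.sum_congr rfl fun l _ => ?_
    rw [← labelWeight_relabel, Function.comp_assoc, Equiv.symm_comp_self, Function.comp_id]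
  induction hx with
  | iso D D' π s ρ hs h =>
    rw [map_sub, freeWeight_gen, freeWeight_gen, hrel D D' π s ρ h]
    simp [hs]
  | as D D' v h =>
    rw [flagFlip_eq] at h
    rw [map_add, freeWeight_gen, freeWeight_gen, hrel D D' _ _ _ h]
    rw [Finset.prod_eq_single v]
    · simp
    · intro w _ hw
      simp [Function.update_of_ne hw]
    · simp
  | ihx D₁ D₂ D₃ v w hvw hedge h₂ h₃ =>
    have h₃' : ∀ x, D₃.edge ((flagCycle v w * flagCycle v w : Equiv.Perm _) x) =
        (flagCycle v w * flagCycle v w : Equiv.Perm _) (D₁.edge x) := by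
      intro x
      simp only [Equiv.Perm.mul_apply]
      rw [h₃, h₂]
    rw [map_add, map_add, freeWeight_gen, freeWeight_gen, freeWeight_gen,
      D₁.weight_of_conj D₂ N _ h₂, D₁.weight_of_conj D₃ N _ h₃', Diagram.weight,
      ← Finset.sum_add_distrib, ← Finset.sum_add_distrib]
    exact D₁.weight_ihx v w hvw hedge

/-- The `gl(N)` weight system `𝓑 → U(gl(N))` for one value of `N`. -/
noncomputable def glWeightSystem (N : ℕ) : DiagramSpace →ₗ[ℂ] GlU N :=
  diagramRelations.liftQ (freeWeight N) (diagramRelations_le_ker N)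

/-- The `gl(N)` weight system with variable `N`: the family of the weight systems for all `N`. -/
noncomputable def glWeightSystemFamily : DiagramSpace →ₗ[ℂ] ((N : ℕ) → GlU N) :=
  LinearMap.pi glWeightSystem

/-!
Resolving each trivalent vertex of a diagram by `t(x, [y, z]) = tr (x y z) - tr (x z y)` writes its
weight as a signed sum over ribbon graphs (`Diagram.weight_eq_sum`). In each term only the boundary
components of the ribbon graph matter: they are the cycles of a permutation `τ` of the flags, and
the term is the sum over all indices `i` of the product of the letters `e_{i x, i (τ x)}` at the
legs `x`, in some order, and of factors `δ_{i x, i (τ x)}` at the other flags (`wordSum`).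

If the legs are met in cyclic order along each boundary component, this is a product of Casimir
elements, one for each cycle of `τ`, whose index is the number of legs on the cycle
(`exists_wordSum_eq_casimirFamily`). Any order can be reached by exchanging neighbouring letters
`a`, `b`, and the commutation relation replaces each exchange by two terms with one letter less, in
which `τ` is multiplied by the transposition of `a` and `b` (`wordSum_swap_sub`).

The number of factors is controlled by a colouring of the flags which is constant on the cycles of
`τ`; at the beginning the colours are the connected components. Multiplying `τ` by a transposition
and merging the two colours concerned, one has
`#cycles - 2 #colours ≤ (#cycles - 2 #colours before) + 1` (`cycleCount_mul_swap_add_le`). This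
gives the genus bound `#cycles - 2 #colours ≤ n - u` for the original ribbon graph
(`Diagram.cycleCount_boundaryPerm_le`), and it shows that `#cycles - 2 #colours + #letters` does not
grow under an exchange of letters. If each colour keeps at least two letters, it follows that there
are at most `n` cycles (`wordSum_mem_casimirSpan`). A colour never falls below two letters, because
the only two letters of a colour commute in the sum (`wordSum_swap_of_color`).

It remains to consider the diagrams with a component with only one leg, and those with more legs
than trivalent vertices. The weight vanishes for both: in the first case the two resolutions of the
vertex at the leg cancel (`Diagram.HasTrivalent.weight_eq_zero_of_single_leg`), in the second case
two legs end at the same vertex (`Diagram.weight_eq_zero_of_two_legs`). If `u ≤ n`, then `u` is a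
bound for the sum of the indices as well.

So the weights of all diagrams of degree `n` lie in the span of the products of at most `n` Casimir
elements whose indices have a sum between `1` and `n`. Such a product is determined by this sum, by
the number (less than `n`) of factors `c_0`, and by the remaining indices, which are the parts
of a partition; this leaves at most `n * n * p(n)` products (`encard_casimir_indices_le`).
-/

/-! ### Cycles of a permutation and colourings -/

section Cycles

variable {ι κ : Type*}

/-- The number of cycles of a permutation, fixed points included. -/
noncomputable def cycleCount (τ : Equiv.Perm ι) : ℕ :=
  (Set.range (Quotient.mk (Equiv.Perm.SameCycle.setoid τ))).ncard

/-- Recolouring: the colour of `b` is replaced by the colour of `a` everywhere. -/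
noncomputable def mergeColor (color : ι → κ) (a b x : ι) : κ :=
  open Classical in if color x = color b then color a else color x

theorem eq_of_sameCycle [Fintype ι] {τ : Equiv.Perm ι} {color : ι → κ}
    (h : ∀ x, color (τ x) = color x) {x y : ι} (hxy : τ.SameCycle x y) : color x = color y := by
  obtain ⟨k, -, rfl⟩ := hxy.exists_pow_eq'
  clear hxy
  induction k with
  | zero => rfl
  | succ k ih => rw [pow_succ', Equiv.Perm.mul_apply, h, ← ih]

theorem mk_apply_eq (τ : Equiv.Perm ι) (x : ι) :
    Quotient.mk (Equiv.Perm.SameCycle.setoid τ) (τ x) = Quotient.mk _ x :=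
  Quotient.sound (show τ.SameCycle (τ x) x from Equiv.Perm.sameCycle_apply_left.2 (.refl _ _))

theorem ncard_range_le_cycleCount [Fintype ι] {τ : Equiv.Perm ι} {color : ι → κ}
    (h : ∀ x, color (τ x) = color x) : (Set.range color).ncard ≤ cycleCount τ := by
  have : Set.range color =
      Quotient.lift color (fun _ _ hxy => eq_of_sameCycle h hxy) ''
        Set.range (Quotient.mk (Equiv.Perm.SameCycle.setoid τ)) := by
    rw [← Set.range_comp]; rfl
  rw [this]
  exact Set.ncard_image_le (Set.finite_range _)

theorem mergeColor_of_eq {color : ι → κ} {a b : ι} (h : color a = color b) :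
    mergeColor color a b = color := by
  funext x
  unfold mergeColor
  split_ifs with hx
  · rw [h, hx]
  · rfl

theorem mergeColor_congr {color : ι → κ} {x y : ι} (h : color x = color y) (a b : ι) :
    mergeColor color a b x = mergeColor color a b y := by
  unfold mergeColor
  rw [h]

theorem mergeColor_left (color : ι → κ) (a b : ι) : mergeColor color a b a = color a := by
  simp [mergeColor]

theorem mergeColor_right (color : ι → κ) (a b : ι) : mergeColor color a b b = color a := by
  simp [mergeColor]

theorem ncard_range_le_mergeColor [Fintype ι] (color : ι → κ) (a b : ι) :
    (Set.range color).ncard ≤ (Set.range (mergeColor color a b)).ncard + 1 := by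
  have : Set.range color ⊆ insert (color b) (Set.range (mergeColor color a b)) := by
    rintro _ ⟨x, rfl⟩
    by_cases hx : color x = color b
    · exact Or.inl hx
    · exact Or.inr ⟨x, by simp [mergeColor, hx]⟩
  exact (Set.ncard_le_ncard this ((Set.finite_range _).insert _)).trans (Set.ncard_insert_le _ _)

theorem mergeColor_mul_swap [DecidableEq ι] {τ : Equiv.Perm ι} {color : ι → κ}
    (h : ∀ x, color (τ x) = color x) (a b x : ι) :
    mergeColor color a b ((τ * Equiv.swap a b) x) = mergeColor color a b x := by
  rw [Equiv.Perm.mul_apply, mergeColor_congr (h _)]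
  rcases eq_or_ne x a with rfl | hxa
  · rw [Equiv.swap_apply_left, mergeColor_left, mergeColor_right]
  rcases eq_or_ne x b with rfl | hxb
  · rw [Equiv.swap_apply_right, mergeColor_left, mergeColor_right]
  rw [Equiv.swap_apply_of_ne_of_ne hxa hxb]

theorem cycleCount_mul_swap_le [Fintype ι] [DecidableEq ι] (τ : Equiv.Perm ι) (a b : ι) :
    cycleCount (τ * Equiv.swap a b) ≤ cycleCount τ + 1 := by
  refine (ncard_range_le_mergeColor _ a b).trans (Nat.add_le_add_right ?_ 1)
  refine ncard_range_le_cycleCount fun x => ?_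
  have := mergeColor_mul_swap (mk_apply_eq (τ * Equiv.swap a b)) a b x
  rwa [mul_assoc, Equiv.swap_mul_self, mul_one] at this

/-- Two points in different cycles of `τ` lie in the same cycle of `τ * swap a b`. -/
theorem sameCycle_mul_swap [Fintype ι] [DecidableEq ι] {τ : Equiv.Perm ι} {a b : ι}
    (hab : ¬ τ.SameCycle a b) :
    (τ * Equiv.swap a b).SameCycle a b := by
  by_contra hcon
  -- Starting from `τ b`, the orbits of `τ` and `τ * swap a b` agree until they reach `b`.
  have key : ∀ k : ℕ, (τ * Equiv.swap a b).SameCycle a ((τ ^ k) (τ b)) := by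
    intro k
    induction k with
    | zero =>
      refine ⟨1, ?_⟩
      simp
    | succ k ih =>
      have hx : (τ ^ k) (τ b) ≠ a := by
        intro h
        refine hab (Equiv.Perm.SameCycle.symm ⟨k + 1, ?_⟩)
        rw [zpow_add_one, Equiv.Perm.mul_apply, zpow_natCast, h]
      have hy : (τ ^ k) (τ b) ≠ b := by
        intro h
        rw [h] at ih
        exact hcon ih
      have : (τ ^ (k + 1)) (τ b) = (τ * Equiv.swap a b) ((τ ^ k) (τ b)) := by
        rw [Equiv.Perm.mul_apply, Equiv.swap_apply_of_ne_of_ne hx hy, pow_succ',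
          Equiv.Perm.mul_apply]
      rw [this]
      exact Equiv.Perm.sameCycle_apply_right.2 ih
  obtain ⟨k, -, hk⟩ := (Equiv.Perm.sameCycle_apply_left.2 (.refl τ b)).exists_pow_eq'
  have := key k
  rw [hk] at this
  exact hcon this

theorem cycleCount_mul_swap_lt [Fintype ι] [DecidableEq ι] {τ : Equiv.Perm ι} {a b : ι}
    (hab : ¬ τ.SameCycle a b) :
    cycleCount (τ * Equiv.swap a b) + 1 ≤ cycleCount τ := by
  set m := Quotient.mk (Equiv.Perm.SameCycle.setoid (τ * Equiv.swap a b)) with hm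
  have hmab : m a = m b := Quotient.sound (sameCycle_mul_swap hab)
  have hinv : ∀ x, m (τ x) = m x := by
    intro x
    have := mergeColor_mul_swap (mk_apply_eq (τ * Equiv.swap a b)) a b x
    rwa [mul_assoc, Equiv.swap_mul_self, mul_one, mergeColor_of_eq hmab] at this
  set q := Quotient.mk (Equiv.Perm.SameCycle.setoid τ) with hq
  have hqab : q a ≠ q b := fun h => hab (Quotient.exact h)
  have hr : Set.range m ⊆ Quotient.lift m (fun _ _ hxy => eq_of_sameCycle hinv hxy) ''
      (Set.range q \ {q b}) := by
    rintro _ ⟨x, rfl⟩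
    by_cases hx : q x = q b
    · refine ⟨q a, ⟨⟨a, rfl⟩, hqab⟩, ?_⟩
      have : m x = m b := eq_of_sameCycle hinv (Quotient.exact hx)
      rw [this, ← hmab]; rfl
    · exact ⟨q x, ⟨⟨x, rfl⟩, hx⟩, rfl⟩
  have h1 := (Set.ncard_le_ncard hr ((Set.finite_range _).subset Set.sdiff_subset |>.image _)).trans
    (Set.ncard_image_le ((Set.finite_range _).subset Set.sdiff_subset))
  have h2 := Set.ncard_sdiff_singleton_add_one (Set.mem_range_self (f := q) b) (Set.finite_range _)
  unfold cycleCount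
  rw [← hm, ← hq]
  omega

/-- The genus bound in one step. A transposition either splits a cycle, or it merges two cycles;
in the second case it merges two colours only if it merges two cycles. -/
theorem cycleCount_mul_swap_add_le [Fintype ι] [DecidableEq ι] {τ : Equiv.Perm ι} {color : ι → κ}
    (h : ∀ x, color (τ x) = color x) (a b : ι) :
    cycleCount (τ * Equiv.swap a b) + 2 * (Set.range color).ncard ≤
      cycleCount τ + 2 * (Set.range (mergeColor color a b)).ncard + 1 := by
  by_cases hab : color a = color b
  · rw [mergeColor_of_eq hab]
    have := cycleCount_mul_swap_le τ a b
    omega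
  · have h1 := cycleCount_mul_swap_lt fun hs : τ.SameCycle a b => hab (eq_of_sameCycle h hs)
    have h2 := ncard_range_le_mergeColor color a b
    omega

end Cycles

/-! ### Index sums of words in the generators -/

section WordSums

variable {ι κ : Type*}

/-- The matrix placed at the position `x`: the matrix `(e_{ij})` of generators if `x ∈ S`, and the
identity matrix otherwise. -/
noncomputable def letterMatrix [DecidableEq ι] (N : ℕ) (S : Finset ι) (x : ι) :
    Matrix (Fin N) (Fin N) (GlU N) :=
  if x ∈ S then glGenMatrix N else 1

/-- The sum over all indices `i : ι → Fin N` of the word with the letters `e_{i x, i (τ x)}` for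
`x ∈ S` and `δ_{i x, i (τ x)}` for `x ∉ S`, multiplied in the order of the list `l`. The letters
outside `S` are scalars; they only make sure that the cycles of `τ` have the right shape. -/
noncomputable def wordSum [Fintype ι] [DecidableEq ι] (N : ℕ) (l : List ι) (S : Finset ι)
    (τ : Equiv.Perm ι) : GlU N :=
  ∑ i : ι → Fin N, (l.map fun x => letterMatrix N S x (i x) (i (τ x))).prod

theorem letterMatrix_of_mem [DecidableEq ι] {N : ℕ} {S : Finset ι} {x : ι} (h : x ∈ S)
    (j k : Fin N) : letterMatrix N S x j k = glGen (j, k) := by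
  rw [letterMatrix, if_pos h]; rfl

theorem letterMatrix_of_notMem [DecidableEq ι] {N : ℕ} {S : Finset ι} {x : ι} (h : x ∉ S)
    (j k : Fin N) : letterMatrix N S x j k = if j = k then 1 else 0 := by
  rw [letterMatrix, if_neg h, Matrix.one_apply]

theorem letterMatrix_congr [DecidableEq ι] {N : ℕ} {S S' : Finset ι} {x : ι}
    (h : x ∈ S ↔ x ∈ S') (j k : Fin N) : letterMatrix N S x j k = letterMatrix N S' x j k := by
  simp only [letterMatrix, h]

/-- Exchanging two neighbouring letters of a word produces, by the commutation relation, the two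
words in which one of the two letters is dropped and `τ` is multiplied by a transposition. -/
theorem wordSum_swap_sub [Fintype ι] [DecidableEq ι] {N : ℕ} {p q : List ι} {a b : ι}
    (hl : (p ++ a :: b :: q).Nodup) {S : Finset ι} (ha : a ∈ S) (hb : b ∈ S)
    (τ : Equiv.Perm ι) :
    wordSum N (p ++ a :: b :: q) S τ - wordSum N (p ++ b :: a :: q) S τ =
      wordSum N (p ++ a :: b :: q) (S.erase b) (τ * Equiv.swap a b) -
        wordSum N (p ++ a :: b :: q) (S.erase a) (τ * Equiv.swap a b) := by
  have hab : a ≠ b := by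
    rintro rfl
    simp [List.nodup_append] at hl
  have hp : ∀ x ∈ p, x ≠ a ∧ x ≠ b := by
    intro x hx
    rw [List.nodup_append] at hl
    exact ⟨hl.2.2 x hx a (by simp), hl.2.2 x hx b (by simp)⟩
  have hq : ∀ x ∈ q, x ≠ a ∧ x ≠ b := by
    intro x hx
    have := (List.nodup_append.1 hl).2.1
    simp only [List.nodup_cons, List.mem_cons, not_or] at this
    exact ⟨fun h => this.1.2 (h ▸ hx), fun h => this.2.1 (h ▸ hx)⟩
  unfold wordSum
  rw [← Finset.sum_sub_distrib, ← Finset.sum_sub_distrib]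
  refine Finset.sum_congr rfl fun i _ => ?_
  have off : ∀ (r : List ι), (∀ x ∈ r, x ≠ a ∧ x ≠ b) → ∀ c, c = a ∨ c = b →
      (r.map fun x => letterMatrix N (S.erase c) x (i x) (i ((τ * Equiv.swap a b) x))) =
      r.map fun x => letterMatrix N S x (i x) (i (τ x)) := by
    intro r hr c hc
    refine List.map_congr_left fun x hx => ?_
    have hxc : x ≠ c := by rcases hc with rfl | rfl; exacts [(hr x hx).1, (hr x hx).2]
    rw [Equiv.Perm.mul_apply, Equiv.swap_apply_of_ne_of_ne (hr x hx).1 (hr x hx).2]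
    exact letterMatrix_congr (by simp [hxc]) _ _
  simp only [List.map_append, List.map_cons, List.prod_append, List.prod_cons]
  rw [off p hp a (.inl rfl), off p hp b (.inr rfl), off q hq a (.inl rfl), off q hq b (.inr rfl),
    letterMatrix_of_mem ha, letterMatrix_of_mem hb,
    letterMatrix_of_mem (Finset.mem_erase.2 ⟨hab, ha⟩),
    letterMatrix_of_mem (Finset.mem_erase.2 ⟨hab.symm, hb⟩),
    letterMatrix_of_notMem (Finset.notMem_erase a S),
    letterMatrix_of_notMem (Finset.notMem_erase b S)]
  simp only [Equiv.Perm.mul_apply, Equiv.swap_apply_left, Equiv.swap_apply_right]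
  rw [← mul_assoc (glGen (i a, i (τ a))), glGen_comm]
  simp only [eq_comm (a := i a), eq_comm (a := i b)]
  split_ifs <;> noncomm_ring

theorem wordSum_swap_of_notMem [Fintype ι] [DecidableEq ι] {N : ℕ} (p q : List ι) {a b : ι}
    {S : Finset ι} (h : a ∉ S ∨ b ∉ S) (τ : Equiv.Perm ι) :
    wordSum N (p ++ a :: b :: q) S τ = wordSum N (p ++ b :: a :: q) S τ := by
  unfold wordSum
  refine Finset.sum_congr rfl fun i _ => ?_
  simp only [List.map_append, List.map_cons, List.prod_append, List.prod_cons]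
  rcases h with h | h
  all_goals
    rw [letterMatrix_of_notMem h]
    split_ifs <;> simp

/-- If `i` is constant along `τ` on a `τ`-invariant set, except at the points of `E`, then the
values of `i` on `E` agree with those of `i ∘ τ` up to their order. -/
theorem sum_exceptional [Fintype ι] [DecidableEq ι] {α : Type*} {τ : Equiv.Perm ι}
    {color : ι → κ} (hc : ∀ x, color (τ x) = color x) (k : κ) (E : Finset ι)
    (hE : ∀ x ∈ E, color x = k) (i : ι → α)
    (hi : ∀ x, color x = k → x ∉ E → i x = i (τ x)) :
    ∑ x ∈ E, ({i x} : Multiset α) = ∑ x ∈ E, {i (τ x)} := by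
  classical
  set C := Finset.univ.filter fun x => color x = k
  have hEC : E ⊆ C := fun x hx => by simp [C, hE x hx]
  have h1 : ∑ x ∈ C, ({i (τ x)} : Multiset α) = ∑ x ∈ C, {i x} :=
    Finset.sum_equiv τ (by simp [C, hc]) (by simp)
  rw [← Finset.sum_sdiff hEC, ← Finset.sum_sdiff hEC,
    Finset.sum_congr rfl fun x (hx : x ∈ C \ E) => by
      rw [← hi x (by simpa [C] using (Finset.mem_sdiff.1 hx).1) (Finset.mem_sdiff.1 hx).2]] at h1
  exact (add_left_cancel h1).symm

/-- A word vanishes at every index at which one of its scalar letters does. -/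
theorem word_eq_zero [DecidableEq ι] {N : ℕ} {l : List ι} {S : Finset ι} {τ : Equiv.Perm ι}
    {i : ι → Fin N} {x : ι} (hl : x ∈ l) (hx : x ∉ S) (h : i x ≠ i (τ x)) :
    (l.map fun x => letterMatrix N S x (i x) (i (τ x))).prod = 0 := by
  refine List.prod_eq_zero (List.mem_map.2 ⟨x, hl, ?_⟩)
  rw [letterMatrix_of_notMem hx, if_neg h]

/-- Two neighbouring letters commute if they are the only letters of their colour: exchanging
their two first indices everywhere in this colour exchanges the two letters. -/
theorem wordSum_swap_of_color [Fintype ι] [DecidableEq ι] {N : ℕ} {p q : List ι} {a b : ι}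
    (hl : (p ++ a :: b :: q).Nodup) (hfull : ∀ x, x ∈ p ++ a :: b :: q)
    {S : Finset ι} (ha : a ∈ S) (hb : b ∈ S) {τ : Equiv.Perm ι}
    {color : ι → κ} (hc : ∀ x, color (τ x) = color x) (hab : color a = color b)
    (hS : ∀ x ∈ S, color x = color a → x = a ∨ x = b) :
    wordSum N (p ++ a :: b :: q) S τ = wordSum N (p ++ b :: a :: q) S τ := by
  classical
  have hne : a ≠ b := by
    rintro rfl
    simp [List.nodup_append] at hl
  have hpq : ∀ x, x ∈ p ∨ x ∈ q → x ≠ a ∧ x ≠ b := by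
    intro x hx
    rw [List.nodup_append] at hl
    rcases hx with hx | hx
    · exact ⟨hl.2.2 x hx a (by simp), hl.2.2 x hx b (by simp)⟩
    · have := hl.2.1
      simp only [List.nodup_cons, List.mem_cons, not_or] at this
      exact ⟨fun h => this.1.2 (h ▸ hx), fun h => this.2.1 (h ▸ hx)⟩
  set Ψ : (ι → Fin N) → ι → Fin N := fun i x =>
    if color x = color a then Equiv.swap (i a) (i b) (i x) else i x with hΨ
  have hΨa : ∀ i, Ψ i a = i b := fun i => by simp [hΨ]
  have hΨb : ∀ i, Ψ i b = i a := fun i => by simp [hΨ, hab]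
  have hinv : Function.Involutive Ψ := by
    intro i
    funext x
    by_cases hx : color x = color a
    · have : ∀ j, color x = color a → Ψ j x = Equiv.swap (j a) (j b) (j x) := fun j h => by
        simp only [hΨ, if_pos h]
      rw [this _ hx, hΨa, hΨb, this _ hx, Equiv.swap_comm, Equiv.swap_apply_self]
    · simp [hΨ, hx]
  unfold wordSum
  refine Fintype.sum_equiv hinv.toPerm _ _ fun i => ?_
  rw [Function.Involutive.coe_toPerm]
  have hΨeq : ∀ i x, color x = color a → (Ψ i x = Ψ i (τ x) ↔ i x = i (τ x)) := by
    intro i x hx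
    simp [hΨ, hx, hc]
  by_cases hsupp : ∀ x, color x = color a → x ∉ ({a, b} : Finset ι) → i x = i (τ x)
  · have hms := sum_exceptional hc (color a) {a, b} (by simp [hab]) i hsupp
    rw [Finset.sum_pair hne, Finset.sum_pair hne] at hms
    have hcases : (i a = i (τ a) ∧ i b = i (τ b)) ∨ (i a = i (τ b) ∧ i b = i (τ a)) := by
      have h1 : i a ∈ ({i (τ a)} + {i (τ b)} : Multiset (Fin N)) := by rw [← hms]; simp
      rw [Multiset.mem_add, Multiset.mem_singleton, Multiset.mem_singleton] at h1
      rcases h1 with h1 | h1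
      · rw [h1] at hms
        exact .inl ⟨h1, by simpa using add_left_cancel hms⟩
      · rw [h1, add_comm {i (τ a)}] at hms
        exact .inr ⟨h1, by simpa using add_left_cancel hms⟩
    have hτa : Ψ i (τ a) = i (τ b) := by
      have : Ψ i (τ a) = Equiv.swap (i a) (i b) (i (τ a)) := by simp [hΨ, hc]
      rw [this]
      rcases hcases with h | h
      · rw [← h.1, Equiv.swap_apply_left, h.2]
      · rw [← h.2, Equiv.swap_apply_right, h.1]
    have hτb : Ψ i (τ b) = i (τ a) := by
      have : Ψ i (τ b) = Equiv.swap (i a) (i b) (i (τ b)) := by simp [hΨ, hc, hab]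
      rw [this]
      rcases hcases with h | h
      · rw [← h.2, Equiv.swap_apply_right, h.1]
      · rw [← h.1, Equiv.swap_apply_left, h.2]
    have off : ∀ r : List ι, (∀ x ∈ r, x ∈ p ∨ x ∈ q) →
        (r.map fun x => letterMatrix N S x (Ψ i x) (Ψ i (τ x))) =
        r.map fun x => letterMatrix N S x (i x) (i (τ x)) := by
      intro r hr
      refine List.map_congr_left fun x hx => ?_
      by_cases hxc : color x = color a
      · have hxS : x ∉ S := by
          intro h
          have := hpq x (hr x hx)
          rcases hS x h hxc with h | h
          exacts [this.1 h, this.2 h]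
        rw [letterMatrix_of_notMem hxS, letterMatrix_of_notMem hxS]
        simp only [hΨeq i x hxc]
      · simp [hΨ, hc, hxc]
    simp only [List.map_append, List.map_cons, List.prod_append, List.prod_cons]
    rw [off p fun _ => .inl, off q fun _ => .inr, hΨa, hΨb, hτa, hτb]
    simp only [letterMatrix_of_mem ha, letterMatrix_of_mem hb]
  · push Not at hsupp
    obtain ⟨x, hx, hxE, hxne⟩ := hsupp
    have hxS : x ∉ S := fun h => hxE (by simpa using hS x h hx)
    have hmem : x ∈ p ++ b :: a :: q := by
      have := hfull x
      simp only [List.mem_append, List.mem_cons] at this ⊢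
      tauto
    rw [word_eq_zero (hfull x) hxS hxne,
      word_eq_zero hmem hxS (fun h => hxne ((hΨeq i x hx).1 h))]

end WordSums

/-! ### Words in cyclic order are products of Casimir elements -/

section CyclicOrder

variable {ι : Type*} {N : ℕ}

/-- Averaging over one index does not change a sum over all indices. -/
theorem sum_sum_update [Fintype ι] [DecidableEq ι] {A : Type*} [AddCommMonoid A]
    (F : (ι → Fin N) → A) (x : ι) :
    ∑ i : ι → Fin N, ∑ j : Fin N, F (Function.update i x j) = N • ∑ i, F i := by
  rw [← Fintype.sum_prod_type', ← Finset.sum_nsmul]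
  have : ∑ i : ι → Fin N, N • F i = ∑ p : (ι → Fin N) × Fin N, F p.1 := by
    rw [Fintype.sum_prod_type]
    simp
  rw [this]
  refine Finset.sum_bij' (fun p _ => (Function.update p.1 x p.2, p.1 x))
    (fun p _ => (Function.update p.1 x p.2, p.1 x)) ?_ ?_ ?_ ?_ ?_ <;> simp

/-- Summation over the indices at the points `y, τ y, …, τ^(k-1) y` of a path from `y` to `z`
multiplies the matrices placed there. The indices at these points become free, which costs a factor
`N` for each of them. -/
theorem sum_path [Fintype ι] [DecidableEq ι] (S : Finset ι) (τ : Equiv.Perm ι) (z : ι)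
    (h : (ι → Fin N) → GlU N) (k : ℕ) :
    ∀ (y : ι) (B : Matrix (Fin N) (Fin N) (GlU N)), τ^[k] y = z →
      (z :: List.iterate τ y k).Nodup →
      (∀ x ∈ List.iterate τ y k, ∀ i j, h (Function.update i x j) = h i) →
      N ^ k • ∑ i : ι → Fin N, B (i z) (i y) *
        (((List.iterate τ y k).map fun x => letterMatrix N S x (i x) (i (τ x))).prod * h i) =
      ∑ i : ι → Fin N, (B * ((List.iterate τ y k).map (letterMatrix N S)).prod) (i z) (i z) *
        h i := by
  induction k with
  | zero =>
    rintro y B rfl - -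
    simp
  | succ k ih =>
    intro y B hz hnd hh
    rw [List.iterate] at hnd hh ⊢
    simp only [List.nodup_cons, List.mem_cons, not_or] at hnd
    have hτ : ∀ x ∈ List.iterate τ (τ y) k, x ≠ y ∧ τ x ≠ y := by
      intro x hx
      refine ⟨fun e => hnd.2.1 (e ▸ hx), fun e => ?_⟩
      obtain ⟨m, hm, rfl⟩ := List.mem_iterate.1 hx
      rw [← Function.iterate_succ_apply' τ] at e
      rcases (Nat.succ_le_of_lt hm).lt_or_eq with h' | h'
      · exact hnd.2.1 (List.mem_iterate.2 ⟨_, h', e.symm⟩)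
      · rw [Function.iterate_succ_apply, ← h', e] at hz
        exact hnd.1.1 hz.symm
    have hτy : τ y ≠ y := by
      rcases k with _ | k
      · exact fun e => hnd.1.1 (hz.symm.trans e)
      · exact (hτ (τ y) (List.mem_iterate.2 ⟨0, by omega, rfl⟩)).1
    have ih' := ih (τ y) (B * letterMatrix N S y) (by rw [← Function.iterate_succ_apply, hz])
      (by simp only [List.nodup_cons]; exact ⟨hnd.1.2, hnd.2.2⟩)
      (fun x hx => hh x (List.mem_cons_of_mem _ hx))
    rw [List.map_cons, List.prod_cons, ← mul_assoc, ← ih', pow_succ, mul_smul]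
    congr 1
    rw [← sum_sum_update _ y]
    refine Finset.sum_congr rfl fun i _ => ?_
    rw [Matrix.mul_apply, Finset.sum_mul]
    refine Finset.sum_congr rfl fun j _ => ?_
    have hmap : (List.iterate τ (τ y) k).map (fun x => letterMatrix N S x
        (Function.update i y j x) (Function.update i y j (τ x))) =
        (List.iterate τ (τ y) k).map fun x => letterMatrix N S x (i x) (i (τ x)) :=
      List.map_congr_left fun x hx => by
        rw [Function.update_of_ne (hτ x hx).1, Function.update_of_ne (hτ x hx).2]
    rw [hh y (by simp), List.map_cons, List.prod_cons, hmap, Function.update_of_ne hnd.1.1,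
      Function.update_self, Function.update_of_ne hτy]
    simp only [mul_assoc]

theorem prod_map_letterMatrix [DecidableEq ι] (S : Finset ι) (l : List ι) :
    (l.map (letterMatrix N S)).prod = glGenMatrix N ^ (l.countP (· ∈ S)) := by
  induction l with
  | nil => simp
  | cons x l ih =>
    rw [List.map_cons, List.prod_cons, ih, letterMatrix, List.countP_cons]
    by_cases hx : x ∈ S <;> simp [hx, pow_succ']

/-- The cycle of `a`, listed from `a` on. -/
noncomputable def cycleList (τ : Equiv.Perm ι) (a : ι) : List ι :=
  List.iterate τ a (Function.minimalPeriod τ a)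

theorem minimalPeriod_perm_pos [Finite ι] (τ : Equiv.Perm ι) (a : ι) :
    0 < Function.minimalPeriod τ a :=
  Function.minimalPeriod_pos_of_mem_periodicPts
    (Function.Injective.mem_periodicPts τ.injective a)

theorem nodup_cycleList (τ : Equiv.Perm ι) (a : ι) : (cycleList τ a).Nodup := by
  have := Function.nodup_periodicOrbit (f := τ) (x := a)
  rwa [Function.periodicOrbit, Cycle.nodup_coe_iff, List.range_map_iterate] at this

theorem mem_cycleList [Finite ι] {τ : Equiv.Perm ι} {a x : ι} :
    x ∈ cycleList τ a ↔ τ.SameCycle a x := by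
  rw [cycleList, List.mem_iterate]
  constructor
  · rintro ⟨m, -, rfl⟩
    exact ⟨m, by rw [zpow_natCast, Equiv.Perm.iterate_eq_pow]⟩
  · intro h
    obtain ⟨k, -, rfl⟩ := h.exists_pow_eq'
    refine ⟨k % Function.minimalPeriod τ a, Nat.mod_lt _ (minimalPeriod_perm_pos τ a), ?_⟩
    rw [Function.iterate_mod_minimalPeriod_eq, Equiv.Perm.iterate_eq_pow]

/-- Splitting off a cycle: a word which starts with the letters of the cycle of `a`, in cyclic
order, is the product of a Casimir element and of the remaining word. -/
theorem sum_cycleList_append [Fintype ι] [DecidableEq ι] (S : Finset ι) (τ : Equiv.Perm ι) (a : ι)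
    (l : List ι) (hl : ∀ x ∈ l, ¬ τ.SameCycle a x) :
    N ^ (cycleList τ a).length • wordSum N (cycleList τ a ++ l) S τ =
      (casimir N ((cycleList τ a).countP (· ∈ S)) : GlU N) * wordSum N l S τ := by
  obtain ⟨k, hk⟩ := Nat.exists_eq_add_of_le' (minimalPeriod_perm_pos τ a)
  have hlist : cycleList τ a = a :: List.iterate τ (τ a) k := by
    rw [cycleList, hk]; rfl
  have hnd := nodup_cycleList τ a
  set h : (ι → Fin N) → GlU N := fun i =>
    (l.map fun x => letterMatrix N S x (i x) (i (τ x))).prod with hh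
  have hind : ∀ x ∈ cycleList τ a, ∀ i j, h (Function.update i x j) = h i := by
    intro x hx i j
    rw [mem_cycleList] at hx
    simp only [hh]
    congr 1
    refine List.map_congr_left fun y hy => ?_
    rw [Function.update_of_ne, Function.update_of_ne]
    · rintro rfl
      exact hl y hy (Equiv.Perm.sameCycle_apply_right.1 hx)
    · rintro rfl
      exact hl y hy hx
  have hper : τ^[k] (τ a) = a := by
    rw [← Function.iterate_succ_apply, Nat.succ_eq_add_one, ← hk]
    exact Function.iterate_minimalPeriod
  have hsplit : wordSum N (cycleList τ a ++ l) S τ = ∑ i : ι → Fin N,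
      letterMatrix N S a (i a) (i (τ a)) * (((List.iterate τ (τ a) k).map fun x =>
        letterMatrix N S x (i x) (i (τ x))).prod * h i) := by
    refine Finset.sum_congr rfl fun i _ => ?_
    rw [hlist, List.cons_append, List.map_cons, List.prod_cons, List.map_append, List.prod_append]
  have hpath := sum_path S τ a h k (τ a) (letterMatrix N S a) hper (hlist ▸ hnd)
    (fun x hx => hind x (hlist ▸ List.mem_cons_of_mem _ hx))
  have hprod : letterMatrix N S a * ((List.iterate τ (τ a) k).map (letterMatrix N S)).prod =
      glGenMatrix N ^ ((cycleList τ a).countP (· ∈ S)) := by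
    rw [← prod_map_letterMatrix, hlist, List.map_cons, List.prod_cons]
  rw [hprod] at hpath
  have hlen : (cycleList τ a).length = k + 1 := by simp [hlist]
  rw [hlen, pow_succ', mul_smul, hsplit, hpath, ← sum_sum_update _ a]
  have hsum : ∀ i : ι → Fin N, ∑ j : Fin N,
      (glGenMatrix N ^ ((cycleList τ a).countP (· ∈ S))) (Function.update i a j a)
        (Function.update i a j a) * h (Function.update i a j) =
      (casimir N ((cycleList τ a).countP (· ∈ S)) : GlU N) * h i := by
    intro i
    simp only [Function.update_self, hind a (mem_cycleList.2 (.refl _ _)) i, ← Finset.sum_mul]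
    rfl
  rw [Finset.sum_congr rfl fun i _ => hsum i, ← Finset.mul_sum]
  rfl

end CyclicOrder

/-- The product of the Casimir elements `c_j`, for `j` in the multiset `s`, as a function of `N`. -/
noncomputable def casimirFamily (s : Multiset ℕ) : (N : ℕ) → GlU N :=
  fun N => ((s.map (casimir N)).prod : Subalgebra.center ℂ (GlU N))

theorem casimirFamily_cons (j : ℕ) (s : Multiset ℕ) (N : ℕ) :
    casimirFamily (j ::ₘ s) N = casimir N j * casimirFamily s N := by
  simp [casimirFamily]

section CyclicOrder

variable {ι : Type*} [Fintype ι] [DecidableEq ι]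

/-- The letters in a union `Q` of cycles of `τ`, listed cycle by cycle, give a product of Casimir
elements. The indices outside `Q` are free, which accounts for the powers of `N`. -/
theorem exists_wordSum_smul_eq (S : Finset ι) (τ : Equiv.Perm ι) (Q : Finset ι)
    (hQ : ∀ x y, τ.SameCycle x y → x ∈ Q → y ∈ Q) :
    ∃ l : List ι, l.Nodup ∧ (∀ x, x ∈ l ↔ x ∈ Q) ∧ ∃ s : Multiset ℕ,
      s.card = (Quotient.mk (Equiv.Perm.SameCycle.setoid τ) '' Q).ncard ∧
      s.sum = (Q.filter (· ∈ S)).card ∧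
      ∀ N, N ^ Q.card • wordSum N l S τ = N ^ Fintype.card ι • casimirFamily s N := by
  induction Q using Finset.strongInduction with
  | H Q ih =>
  rcases Q.eq_empty_or_nonempty with rfl | ⟨a, ha⟩
  · refine ⟨[], List.nodup_nil, by simp, 0, by simp, by simp, fun N => ?_⟩
    simp [wordSum, casimirFamily]
  set C := Finset.univ.filter fun x => τ.SameCycle a x with hC
  have hCQ : C ⊆ Q := fun x hx => hQ a x (by simpa [hC] using hx) ha
  have haC : a ∈ C := by simp [hC, Equiv.Perm.SameCycle.refl]
  have hcard : C.card = (cycleList τ a).length := by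
    rw [← List.toFinset_card_of_nodup (nodup_cycleList τ a)]
    congr 1
    ext x
    simp [hC, mem_cycleList]
  have hcount : (C.filter (· ∈ S)).card = (cycleList τ a).countP (· ∈ S) := by
    rw [List.countP_eq_length_filter,
      ← List.toFinset_card_of_nodup ((nodup_cycleList τ a).filter _)]
    congr 1
    ext x
    simp [hC, mem_cycleList]
  obtain ⟨l, hnd, hmem, s, hs1, hs2, hs3⟩ := ih (Q \ C)
    (Finset.sdiff_ssubset hCQ ⟨a, haC⟩) (by
      intro x y hxy hx
      rw [Finset.mem_sdiff] at hx ⊢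
      refine ⟨hQ x y hxy hx.1, fun hy => hx.2 ?_⟩
      simp only [hC, Finset.mem_filter, Finset.mem_univ, true_and] at hy ⊢
      exact hy.trans hxy.symm)
  have hl : ∀ x ∈ l, ¬ τ.SameCycle a x := by
    intro x hx
    have := ((hmem x).1 hx)
    simpa [hC] using (Finset.mem_sdiff.1 this).2
  refine ⟨cycleList τ a ++ l, ?_, ?_, (cycleList τ a).countP (· ∈ S) ::ₘ s, ?_, ?_, ?_⟩
  · refine (nodup_cycleList τ a).append hnd fun x hx hx' => hl x hx' (mem_cycleList.1 hx)
  · intro x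
    rw [List.mem_append, mem_cycleList, hmem, Finset.mem_sdiff]
    have : x ∈ C ↔ τ.SameCycle a x := by simp [hC]
    rw [this]
    constructor
    · rintro (h | h)
      exacts [hQ a x h ha, h.1]
    · intro h
      by_cases h' : τ.SameCycle a x
      exacts [.inl h', .inr ⟨h, h'⟩]
  · rw [Multiset.card_cons, hs1]
    have himg : Quotient.mk (Equiv.Perm.SameCycle.setoid τ) '' Q =
        insert (Quotient.mk _ a)
          (Quotient.mk (Equiv.Perm.SameCycle.setoid τ) '' (Q \ C : Finset ι)) := by
      ext c
      constructor
      · rintro ⟨x, hx, rfl⟩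
        by_cases h : τ.SameCycle a x
        · exact .inl (Quotient.sound h.symm)
        · exact .inr ⟨x, by simpa [hC, h] using hx, rfl⟩
      · rintro (rfl | ⟨x, hx, rfl⟩)
        · exact ⟨a, ha, rfl⟩
        · exact ⟨x, (Finset.mem_sdiff.1 hx).1, rfl⟩
    rw [himg, Set.ncard_insert_of_notMem _ ((Finset.finite_toSet _).image _)]
    rintro ⟨x, hx, hxa⟩
    have h1 : τ.SameCycle x a := Quotient.exact hxa
    exact (Finset.mem_sdiff.1 hx).2 (by simpa [hC] using h1.symm)
  · rw [Multiset.sum_cons, hs2, ← hcount, ← Finset.card_union_of_disjoint]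
    · rw [← Finset.filter_union, Finset.union_sdiff_of_subset hCQ]
    · exact Finset.disjoint_filter_filter Finset.disjoint_sdiff
  · intro N
    have : Q.card = (Q \ C).card + (cycleList τ a).length := by
      rw [← hcard, Finset.card_sdiff_add_card_eq_card hCQ]
    rw [this, pow_add, mul_smul, sum_cycleList_append S τ a l hl, casimirFamily_cons,
      ← mul_smul_comm, hs3, mul_smul_comm]

/-- If the letters are listed cycle by cycle, each cycle in its cyclic order, the word is a product
of Casimir elements, one for each cycle. -/
theorem exists_wordSum_eq_casimirFamily [Nonempty ι] (S : Finset ι) (τ : Equiv.Perm ι) :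
    ∃ l : List ι, l.Nodup ∧ (∀ x, x ∈ l) ∧ ∃ s : Multiset ℕ, s.card = cycleCount τ ∧
      s.sum = S.card ∧ ∀ N, wordSum N l S τ = casimirFamily s N := by
  obtain ⟨l, hnd, hmem, s, hs1, hs2, hs3⟩ := exists_wordSum_smul_eq S τ Finset.univ (by simp)
  have hs1' : s.card = cycleCount τ := by rw [hs1, cycleCount, Finset.coe_univ, Set.image_univ]
  refine ⟨l, hnd, by simpa using hmem, s, hs1', by simpa using hs2, fun N => ?_⟩
  have h := hs3 N
  rw [Finset.card_univ] at h
  rcases Nat.eq_zero_or_pos N with rfl | hN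
  · -- There are no indices, so that both sides vanish.
    have hpos : 0 < s.card := by
      rw [hs1', cycleCount, Set.ncard_pos]
      exact Set.range_nonempty _
    obtain ⟨j, hj⟩ := Multiset.card_pos_iff_exists_mem.1 hpos
    obtain ⟨s', rfl⟩ := Multiset.exists_cons_of_mem hj
    rw [casimirFamily_cons]
    have h0 : (casimir 0 j : GlU 0) = 0 := by simp [casimir, Matrix.trace]
    rw [h0, zero_mul, wordSum, Finset.sum_eq_zero]
    intro i _
    exact (i (Classical.arbitrary ι)).elim0
  · rw [← Nat.cast_smul_eq_nsmul ℂ, ← Nat.cast_smul_eq_nsmul ℂ] at h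
    exact smul_right_injective _ (by exact_mod_cast (pow_pos hN _).ne') h

end CyclicOrder

/-! ### Reduction of words to Casimir elements -/

/-- The span of the products of at most `r` Casimir elements, the factors `c_0` included, whose
indices have a sum between `1` and `w`, as functions of `N`. -/
noncomputable def casimirSpan (w r : ℕ) : Submodule ℂ ((N : ℕ) → GlU N) :=
  Submodule.span ℂ (casimirFamily '' {s | 1 ≤ s.sum ∧ s.sum ≤ w ∧ s.card ≤ r})

section Reduction

variable {ι κ : Type*}

/-- Every colour which occurs is the colour of at least two elements of `S`. -/
def TwoOfEachColor (S : Finset ι) (color : ι → κ) : Prop :=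
  ∀ x, ∃ y ∈ S, ∃ z ∈ S, y ≠ z ∧ color y = color x ∧ color z = color x

theorem TwoOfEachColor.two_mul_ncard_le [Fintype ι] {S : Finset ι} {color : ι → κ}
    (h : TwoOfEachColor S color) : 2 * (Set.range color).ncard ≤ S.card := by
  classical
  have himg : Set.range color = (S.image color : Finset κ) := by
    ext k
    simp only [Set.mem_range, Finset.coe_image, Set.mem_image, Finset.mem_coe]
    constructor
    · rintro ⟨x, rfl⟩
      obtain ⟨y, hy, -, -, -, h1, -⟩ := h x
      exact ⟨y, hy, h1⟩
    · rintro ⟨x, -, rfl⟩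
      exact ⟨x, rfl⟩
  rw [himg, Set.ncard_coe_finset]
  refine Finset.mul_card_image_le_card S 2 fun k hk => ?_
  obtain ⟨x, -, rfl⟩ := Finset.mem_image.1 hk
  obtain ⟨y, hy, z, hz, hyz, h1, h2⟩ := h x
  rw [← Finset.card_pair hyz]
  refine Finset.card_le_card fun w hw => ?_
  rcases Finset.mem_insert.1 hw with rfl | hw
  · simp [hy, h1]
  · rw [Finset.mem_singleton.1 hw]
    simp [hz, h2]

theorem TwoOfEachColor.erase [DecidableEq ι] {S : Finset ι} {color : ι → κ}
    (h : TwoOfEachColor S color) {a b c : ι} (ha : a ∈ S) (hb : b ∈ S) (hne : a ≠ b)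
    (hc : c = a ∨ c = b)
    (hab : color a ≠ color b ∨ ∃ d ∈ S, color d = color a ∧ d ≠ a ∧ d ≠ b) :
    TwoOfEachColor (S.erase c) (mergeColor color a b) := by
  intro x
  by_cases hcol : color a = color b
  · obtain ⟨d, hd, hda, hd1, hd2⟩ := hab.resolve_left (not_not.2 hcol)
    rw [mergeColor_of_eq hcol]
    by_cases hx : color x = color a
    · rcases hc with rfl | rfl
      · exact ⟨b, by simp [hb, hne.symm], d, by simp [hd, hd1], hd2.symm, by rw [hx, hcol],
          by rw [hx, hda]⟩
      · exact ⟨a, by simp [ha, hne], d, by simp [hd, hd2], hd1.symm, by rw [hx],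
          by rw [hx, hda]⟩
    · have hxc : color x ≠ color c := by rcases hc with rfl | rfl; exacts [hx, hcol ▸ hx]
      obtain ⟨y, hy, z, hz, hyz, h1, h2⟩ := h x
      exact ⟨y, Finset.mem_erase.2 ⟨fun e => hxc (by rw [← h1, e]), hy⟩,
        z, Finset.mem_erase.2 ⟨fun e => hxc (by rw [← h2, e]), hz⟩, hyz, h1, h2⟩
  · -- A point `x'` of the same new colour as `x`, whose old colour is not that of `c`.
    obtain ⟨x', hx', hx'c⟩ : ∃ x', mergeColor color a b x = mergeColor color a b x' ∧
        color x' ≠ color c := by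
      by_cases hx : color x = color a ∨ color x = color b
      · have hxa : mergeColor color a b x = color a := by
          rcases hx with hx | hx
          · rw [mergeColor_congr hx, mergeColor_left]
          · rw [mergeColor_congr hx, mergeColor_right]
        rcases hc with rfl | rfl
        · exact ⟨b, by rw [hxa, mergeColor_right], Ne.symm hcol⟩
        · exact ⟨a, by rw [hxa, mergeColor_left], hcol⟩
      · push Not at hx
        refine ⟨x, rfl, ?_⟩
        rcases hc with rfl | rfl
        exacts [hx.1, hx.2]
    obtain ⟨y, hy, z, hz, hyz, h1, h2⟩ := h x'
    exact ⟨y, Finset.mem_erase.2 ⟨fun e => hx'c (by rw [← h1, e]), hy⟩,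
      z, Finset.mem_erase.2 ⟨fun e => hx'c (by rw [← h2, e]), hz⟩, hyz,
      by rw [hx', mergeColor_congr h1], by rw [hx', mergeColor_congr h2]⟩

/-- If neighbouring letters may be exchanged modulo a submodule, all letters may be permuted. -/
theorem sub_mem_of_perm {A : Type*} [AddCommGroup A] [Module ℂ A] (M : Submodule ℂ A)
    (V : List ι → A) (L : List ι)
    (hV : ∀ p a b q, List.Perm (p ++ a :: b :: q) L →
      V (p ++ a :: b :: q) - V (p ++ b :: a :: q) ∈ M)
    {l l' : List ι} (h : List.Perm l l') :
    ∀ p, List.Perm (p ++ l) L → V (p ++ l) - V (p ++ l') ∈ M := by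
  induction h with
  | nil => intro p _; rw [sub_self]; exact M.zero_mem
  | cons x _ ih =>
    intro p hp
    simpa using ih (p ++ [x]) (by simpa using hp)
  | swap a b q => intro p hp; exact hV p b a q hp
  | trans h1 _ ih1 ih2 =>
    intro p hp
    rw [← sub_add_sub_cancel]
    exact M.add_mem (ih1 p hp) (ih2 p ((List.Perm.append_left p h1.symm).trans hp))

/-- Each exchange of neighbouring letters lowers the number of letters by one, while
`cycleCount τ - 2 * (number of colours)` grows by at most one. -/
theorem wordSum_mem_casimirSpan [Fintype ι] [DecidableEq ι] [Nonempty ι] (w r m : ℕ) :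
    ∀ (S : Finset ι) (τ : Equiv.Perm ι) (color : ι → κ) (l : List ι), S.card = m → S.card ≤ w →
      (∀ x, color (τ x) = color x) → TwoOfEachColor S color →
      cycleCount τ + S.card ≤ r + 2 * (Set.range color).ncard →
      l.Nodup → (∀ x, x ∈ l) → (fun N => wordSum N l S τ) ∈ casimirSpan w r := by
  induction m with
  | zero =>
    intro S τ color l hm _ _ htwo
    obtain ⟨y, hy, -⟩ := htwo (Classical.arbitrary ι)
    rw [Finset.card_eq_zero.1 hm] at hy
    simp at hy
  | succ m ih =>
    intro S τ color l hm hw hc htwo hr hnd hfull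
    obtain ⟨l₀, hnd₀, hfull₀, s, hs1, hs2, hs3⟩ := exists_wordSum_eq_casimirFamily S τ
    have hperm : List.Perm l l₀ :=
      (List.perm_ext_iff_of_nodup hnd hnd₀).2 fun x => by simp [hfull, hfull₀]
    have hsub := sub_mem_of_perm (casimirSpan w r) (fun l N => wordSum N l S τ) l ?_ hperm []
      (List.Perm.refl _)
    · have h0 : (fun N => wordSum N l₀ S τ) ∈ casimirSpan w r := by
        refine Submodule.subset_span ⟨s, ⟨?_, ?_, ?_⟩, funext fun N => (hs3 N).symm⟩
        · omega
        · omega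
        · have := htwo.two_mul_ncard_le
          omega
      have := Submodule.add_mem _ hsub h0
      simpa using this
    · intro p a b q hpq
      have hnd' := hpq.nodup_iff.2 hnd
      have hfull' : ∀ x, x ∈ p ++ a :: b :: q := fun x => hpq.mem_iff.2 (hfull x)
      by_cases hS : a ∈ S ∧ b ∈ S
      swap
      · have : ∀ N, wordSum N (p ++ a :: b :: q) S τ = wordSum N (p ++ b :: a :: q) S τ :=
          fun N => wordSum_swap_of_notMem p q (by tauto) τ
        simp only [this, sub_self, Submodule.zero_mem]
      obtain ⟨ha, hb⟩ := hS
      by_cases hcol : color a = color b ∧ ∀ x ∈ S, color x = color a → x = a ∨ x = b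
      · have : ∀ N, wordSum N (p ++ a :: b :: q) S τ = wordSum N (p ++ b :: a :: q) S τ :=
          fun N => wordSum_swap_of_color hnd' hfull' ha hb hc hcol.1 hcol.2
        simp only [this, sub_self, Submodule.zero_mem]
      have hab : color a ≠ color b ∨ ∃ d ∈ S, color d = color a ∧ d ≠ a ∧ d ≠ b := by
        by_contra! h
        exact hcol ⟨h.1, fun x hx hxa => or_iff_not_imp_left.2 (h.2 x hx hxa)⟩
      have hne : a ≠ b := by
        rintro rfl
        simp [List.nodup_append] at hnd'
      have hterm : ∀ c ∈ S, c = a ∨ c = b →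
          (fun N => wordSum N (p ++ a :: b :: q) (S.erase c) (τ * Equiv.swap a b)) ∈
            casimirSpan w r := by
        intro c hcS hcab
        have hcard := Finset.card_erase_of_mem hcS
        refine ih (S.erase c) (τ * Equiv.swap a b) (mergeColor color a b) _ (by omega) (by omega)
          (mergeColor_mul_swap hc a b) (htwo.erase ha hb hne hcab hab) ?_ hnd' hfull'
        have := cycleCount_mul_swap_add_le hc a b
        omega
      have heq : ((fun N => wordSum N (p ++ a :: b :: q) S τ) -
          fun N => wordSum N (p ++ b :: a :: q) S τ) =
          (fun N => wordSum N (p ++ a :: b :: q) (S.erase b) (τ * Equiv.swap a b)) -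
          fun N => wordSum N (p ++ a :: b :: q) (S.erase a) (τ * Equiv.swap a b) :=
        funext fun N => wordSum_swap_sub hnd' ha hb τ
      rw [heq]
      exact Submodule.sub_mem _ (hterm b hb (.inr rfl)) (hterm a ha (.inl rfl))

end Reduction

/-! ### The weight of a diagram as a sum over resolutions -/

section Resolutions

variable {t u : ℕ}

/-- The gluing of the flags as a permutation. -/
def Diagram.edgePerm (D : Diagram t u) : Equiv.Perm (HalfEdge t u) :=
  Function.Involutive.toPerm D.edge D.edge_edge

theorem Diagram.edgePerm_apply (D : Diagram t u) (h : HalfEdge t u) : D.edgePerm h = D.edge h :=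
  rfl

/-- The two rotations of the three flags at a trivalent vertex. -/
def vertexTurn (b : Bool) : Equiv.Perm (Fin 3) :=
  Equiv.addRight (bif b then 2 else 1)

/-- The sign of the corresponding term of `t(x, [y, z]) = tr (x y z) - tr (x z y)`. -/
def turnSign (b : Bool) : ℂ := bif b then 1 else -1

/-- The boundary permutation of the ribbon graph in which the trivalent vertex `v` is resolved
according to `ε v`: turn at the vertex, then follow the edge. Its cycles are the boundary
components. -/
def Diagram.boundaryPerm (D : Diagram t u) (ε : Fin t → Bool) : Equiv.Perm (HalfEdge t u) :=
  D.edgePerm * flagRelabel 1 (fun v => vertexTurn (ε v)) 1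

theorem Diagram.boundaryPerm_inl (D : Diagram t u) (ε : Fin t → Bool) (v : Fin t) (k : Fin 3) :
    D.boundaryPerm ε (Sum.inl (v, k)) = D.edge (Sum.inl (v, vertexTurn (ε v) k)) := rfl

theorem Diagram.boundaryPerm_inr (D : Diagram t u) (ε : Fin t → Bool) (j : Fin u) :
    D.boundaryPerm ε (Sum.inr j) = D.edge (Sum.inr j) := rfl

/-- The flags at the univalent vertices. -/
def legSet (t u : ℕ) : Finset (HalfEdge t u) := Finset.univ.map Function.Embedding.inr

theorem inr_mem_legSet (j : Fin u) : (Sum.inr j : HalfEdge t u) ∈ legSet t u := by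
  simp [legSet]

theorem inl_notMem_legSet (x : Fin t × Fin 3) : (Sum.inl x : HalfEdge t u) ∉ legSet t u := by
  simp [legSet]

theorem card_legSet : (legSet t u).card = u := by simp [legSet]

/-- All flags, the legs being listed last, in the order given by `π`. -/
noncomputable def flagList (t : ℕ) {u : ℕ} (π : Equiv.Perm (Fin u)) : List (HalfEdge t u) :=
  (Finset.univ : Finset (Fin t × Fin 3)).toList.map Sum.inl ++ List.ofFn fun k => Sum.inr (π k)

theorem nodup_flagList (π : Equiv.Perm (Fin u)) : (flagList t π).Nodup := by
  refine List.Nodup.append ?_ ?_ ?_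
  · exact (Finset.nodup_toList _).map Sum.inl_injective
  · exact List.nodup_ofFn.2 (Sum.inr_injective.comp π.injective)
  · intro x hx hx'
    obtain ⟨y, -, rfl⟩ := List.mem_map.1 hx
    obtain ⟨k, hk⟩ := (List.mem_ofFn' _ _).1 hx'
    cases hk

theorem mem_flagList (π : Equiv.Perm (Fin u)) (x : HalfEdge t u) : x ∈ flagList t π := by
  rcases x with x | j
  · exact List.mem_append_left _ (List.mem_map.2 ⟨x, by simp, rfl⟩)
  · exact List.mem_append_right _ ((List.mem_ofFn' _ _).2 ⟨π.symm j, by simp⟩)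

theorem structureTensor_eq {N : ℕ} (p q r : Fin N × Fin N) :
    structureTensor p q r =
      (if p.1 = r.2 then 1 else 0) * (if q.1 = p.2 then 1 else 0) * (if r.1 = q.2 then 1 else 0) -
      (if p.1 = q.2 then 1 else 0) * (if q.1 = r.2 then 1 else 0) *
        (if r.1 = p.2 then 1 else 0) := by
  obtain ⟨p1, p2⟩ := p
  obtain ⟨q1, q2⟩ := q
  obtain ⟨r1, r2⟩ := r
  simp only [structureTensor, matUnit, LieRing.of_associative_ring_bracket,
    Matrix.trace_single_mul, Matrix.sub_apply, Matrix.mul_apply, Matrix.single_apply, one_smul,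
    mul_ite, mul_one, mul_zero, ite_and, Finset.sum_ite_eq, Finset.mem_univ, if_true]
  grind

theorem Diagram.structureTensor_eq_sum (D : Diagram t u) {N : ℕ} (i : HalfEdge t u → Fin N)
    (v : Fin t) :
    structureTensor (i (Sum.inl (v, 0)), i (D.edge (Sum.inl (v, 0))))
      (i (Sum.inl (v, 1)), i (D.edge (Sum.inl (v, 1))))
      (i (Sum.inl (v, 2)), i (D.edge (Sum.inl (v, 2)))) =
    ∑ b : Bool, turnSign b * ∏ k : Fin 3,
      if i (Sum.inl (v, k)) = i (D.edge (Sum.inl (v, vertexTurn b k))) then 1 else 0 := by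
  have h1 : (1 : Fin 3) + 2 = 0 := rfl
  have h2 : (2 : Fin 3) + 2 = 1 := rfl
  have h3 : (2 : Fin 3) + 1 = 0 := rfl
  have h4 : (1 : Fin 3) + 1 = 2 := rfl
  simp only [structureTensor_eq, Fintype.sum_bool, Fin.prod_univ_three, turnSign, vertexTurn,
    Equiv.coe_addRight, cond_true, cond_false, zero_add, h1, h2, h3, h4]
  ring

theorem Diagram.sum_labelings (D : Diagram t u) {N : ℕ} {A : Type*} [AddCommMonoid A]
    (F : (HalfEdge t u → Fin N × Fin N) → A) :
    ∑ l ∈ D.labelings N, F l = ∑ i : HalfEdge t u → Fin N, F fun h => (i h, i (D.edge h)) := by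
  refine Finset.sum_bij' (fun l _ h => (l h).1) (fun i _ h => (i h, i (D.edge h))) ?_ ?_ ?_ ?_ ?_
  · simp
  · intro i _
    simp [Diagram.labelings, D.edge_edge]
  · intro l hl
    simp only [Diagram.labelings, Finset.mem_filter, Finset.mem_univ, true_and] at hl
    funext h
    simp [hl h]
  · intro i _; rfl
  · intro l hl
    simp only [Diagram.labelings, Finset.mem_filter, Finset.mem_univ, true_and] at hl
    congr 1
    funext h
    simp [hl h]

theorem Diagram.prod_flagList (D : Diagram t u) (ε : Fin t → Bool) {N : ℕ}
    (i : HalfEdge t u → Fin N) (π : Equiv.Perm (Fin u)) :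
    ((flagList t π).map fun x =>
      letterMatrix N (legSet t u) x (i x) (i (D.boundaryPerm ε x))).prod =
    (∏ v : Fin t, ∏ k : Fin 3,
      if i (Sum.inl (v, k)) = i (D.edge (Sum.inl (v, vertexTurn (ε v) k))) then (1 : ℂ) else 0) •
      (List.ofFn fun k => glGen (i (Sum.inr (π k)), i (D.edge (Sum.inr (π k))))).prod := by
  rw [flagList, List.map_append, List.prod_append, List.map_map, Algebra.smul_def]
  congr 1
  · rw [← Fintype.prod_prod_type', ← Finset.prod_map_toList, map_list_prod, List.map_map]
    congr 1
    refine List.map_congr_left fun x _ => ?_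
    rw [Function.comp_apply, Function.comp_apply, letterMatrix_of_notMem (inl_notMem_legSet x),
      D.boundaryPerm_inl]
    split_ifs <;> simp
  · rw [List.map_ofFn]
    congr 2
    funext k
    rw [Function.comp_apply, letterMatrix_of_mem (inr_mem_legSet _), D.boundaryPerm_inr]

/-- The weight of a diagram, expanded over the two terms of the structure tensor at each trivalent
vertex: a signed sum over ribbon graphs. -/
theorem Diagram.weight_eq_sum (D : Diagram t u) (N : ℕ) :
    D.weight N = ∑ ε : Fin t → Bool, (∏ v, turnSign (ε v)) • ((u.factorial : ℂ)⁻¹ •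
      ∑ π : Equiv.Perm (Fin u), wordSum N (flagList t π) (legSet t u) (D.boundaryPerm ε)) := by
  unfold Diagram.weight wordSum
  rw [D.sum_labelings]
  simp only [D.prod_flagList]
  have h : ∀ i : HalfEdge t u → Fin N, labelWeight (fun h => (i h, i (D.edge h))) =
      ∑ ε : Fin t → Bool, (∏ v, turnSign (ε v)) • ((u.factorial : ℂ)⁻¹ •
        ∑ π : Equiv.Perm (Fin u), (∏ v : Fin t, ∏ k : Fin 3,
          if i (Sum.inl (v, k)) = i (D.edge (Sum.inl (v, vertexTurn (ε v) k)))
            then (1 : ℂ) else 0) •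
          (List.ofFn fun k => glGen (i (Sum.inr (π k)), i (D.edge (Sum.inr (π k))))).prod) := by
    intro i
    simp only [labelWeight, D.structureTensor_eq_sum, symWord]
    rw [Fintype.prod_sum, Finset.sum_smul]
    refine Finset.sum_congr rfl fun ε _ => ?_
    rw [Finset.prod_mul_distrib, mul_smul, ← Finset.smul_sum, smul_comm (u.factorial : ℂ)⁻¹]
  simp only [h]
  rw [Finset.sum_comm]
  refine Finset.sum_congr rfl fun ε _ => ?_
  rw [← Finset.smul_sum, ← Finset.smul_sum, Finset.sum_comm]

end Resolutions

/-! ### The genus bound -/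

section Genus

variable {t u : ℕ}

theorem flagRelabel_update (s : Fin t → Equiv.Perm (Fin 3)) (v : Fin t) (i j : Fin 3) :
    (flagRelabel 1 (Function.update s v (s v * Equiv.swap i j)) 1 : Equiv.Perm (HalfEdge t u)) =
      flagRelabel 1 s 1 * Equiv.swap (Sum.inl (v, i)) (Sum.inl (v, j)) := by
  ext1 x
  rcases x with ⟨w, k⟩ | l
  · by_cases hw : w = v
    · subst hw
      by_cases hi : k = i
      · subst hi
        simp [flagRelabel]
      · by_cases hj : k = j
        · subst hj
          simp [flagRelabel]
        · simp [flagRelabel, Equiv.swap_apply_of_ne_of_ne, hi, hj]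
    · simp [flagRelabel, Equiv.swap_apply_of_ne_of_ne, hw]
  · simp [flagRelabel, Equiv.swap_apply_of_ne_of_ne]

theorem vertexTurn_eq_swap (b : Bool) :
    ∃ i j k l : Fin 3, vertexTurn b = Equiv.swap i j * Equiv.swap k l := by
  cases b
  · exact ⟨0, 1, 1, 2, by decide⟩
  · exact ⟨1, 2, 0, 1, by decide⟩

/-- The involution of the flags has at least half as many cycles as there are flags. -/
theorem Diagram.card_le_two_mul_cycleCount (D : Diagram t u) :
    t * 3 + u ≤ 2 * cycleCount D.edgePerm := by
  classical
  have hcard : (Finset.univ : Finset (HalfEdge t u)).card = t * 3 + u := by simp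
  rw [← hcard, cycleCount, ← Set.image_univ, ← Finset.coe_univ, ← Finset.coe_image,
    Set.ncard_coe_finset]
  refine Finset.card_le_mul_card_image _ 2 fun c hc => ?_
  obtain ⟨x, -, rfl⟩ := Finset.mem_image.1 hc
  refine (Finset.card_le_card (t := {x, D.edge x}) fun y hy => ?_).trans Finset.card_le_two
  have hxy : D.edgePerm.SameCycle y x := Quotient.exact (Finset.mem_filter.1 hy).2
  obtain ⟨k, -, rfl⟩ := hxy.symm.exists_pow_eq'
  clear hxy hy
  induction k with
  | zero => simp
  | succ k ih =>
    rw [pow_succ', Equiv.Perm.mul_apply, D.edgePerm_apply]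
    rw [Finset.mem_insert, Finset.mem_singleton] at ih ⊢
    rcases ih with ih | ih
    · rw [ih]; exact .inr rfl
    · rw [ih]; exact .inl (D.edge_edge x)

/-- A colouring which is constant on edges and on the cycles of `s` at the vertices, and which
has enough colours for the gluing permutation composed with `s` to have its number of cycles
bounded as it is after `m` transpositions. -/
def Diagram.GenusBound (D : Diagram t u) (s : Fin t → Equiv.Perm (Fin 3)) (m : ℕ) : Prop :=
  ∃ color : HalfEdge t u → Quotient (Equiv.Perm.SameCycle.setoid D.edgePerm),
    (∀ x, color (D.edge x) = color x) ∧ (∀ x, color (flagRelabel 1 s 1 x) = color x) ∧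
    cycleCount (D.edgePerm * flagRelabel 1 s 1) + cycleCount D.edgePerm ≤
      2 * (Set.range color).ncard + m

theorem Diagram.genusBound_one (D : Diagram t u) : D.GenusBound 1 0 := by
  have h1 : (flagRelabel 1 1 1 : Equiv.Perm (HalfEdge t u)) = 1 := by
    ext1 x
    rcases x with x | x <;> simp [flagRelabel]
  refine ⟨Quotient.mk _, mk_apply_eq D.edgePerm, fun x => by rw [h1]; rfl, ?_⟩
  rw [h1, mul_one, cycleCount]
  omega

theorem Diagram.GenusBound.update {D : Diagram t u} {s : Fin t → Equiv.Perm (Fin 3)} {m : ℕ}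
    (h : D.GenusBound s m) (v : Fin t) (i j : Fin 3) :
    D.GenusBound (Function.update s v (s v * Equiv.swap i j)) (m + 1) := by
  obtain ⟨color, h1, h2, h3⟩ := h
  refine ⟨mergeColor color (Sum.inl (v, i)) (Sum.inl (v, j)), fun x => mergeColor_congr (h1 x) _ _,
    ?_, ?_⟩
  · rw [flagRelabel_update]
    exact mergeColor_mul_swap h2 _ _
  · rw [flagRelabel_update, ← mul_assoc]
    have := cycleCount_mul_swap_add_le (τ := D.edgePerm * flagRelabel 1 s 1) (color := color)
      (fun x => (h1 _).trans (h2 x)) (Sum.inl (v, i)) (Sum.inl (v, j))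
    omega

theorem Diagram.genusBound_vertexTurn (D : Diagram t u) (ε : Fin t → Bool) :
    D.GenusBound (fun v => vertexTurn (ε v)) (2 * t) := by
  have key : ∀ Q : Finset (Fin t),
      D.GenusBound (fun v => if v ∈ Q then vertexTurn (ε v) else 1) (2 * Q.card) := by
    intro Q
    induction Q using Finset.induction_on with
    | empty => simpa using! D.genusBound_one
    | insert v Q hv ih =>
      obtain ⟨i, j, k, l, hε⟩ := vertexTurn_eq_swap (ε v)
      have := (ih.update v i j).update v k l
      rw [Finset.card_insert_of_notMem hv, Nat.mul_succ]
      convert this using 1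
      funext w
      by_cases hw : w = v
      · subst hw
        simp [hv, hε]
      · simp [hw]
  simpa using key Finset.univ

/-- A function on the vertices which takes the same value at both ends of each edge is constant on
connected components. -/
theorem Diagram.eq_of_reachable (D : Diagram t u) {α : Type*} {f : Fin t ⊕ Fin u → α}
    (hf : ∀ h, f (HalfEdge.vertex h) = f (HalfEdge.vertex (D.edge h))) {p q : Fin t ⊕ Fin u}
    (hpq : (flagGraph D.edge).Reachable p q) : f p = f q := by
  obtain ⟨w⟩ := hpq
  induction w with
  | nil => rfl
  | cons hadj _ ih =>
    rw [← ih]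
    rw [flagGraph, SimpleGraph.fromRel_adj] at hadj
    rcases hadj.2 with ⟨h, rfl, rfl⟩ | ⟨h, rfl, rfl⟩
    · exact hf h
    · exact (hf h).symm

/-- The connected component of a flag. -/
def Diagram.component (D : Diagram t u) (h : HalfEdge t u) :
    (flagGraph D.edge).ConnectedComponent :=
  (flagGraph D.edge).connectedComponentMk (HalfEdge.vertex h)

theorem Diagram.component_eq_of_vertex (D : Diagram t u) {h h' : HalfEdge t u}
    (e : HalfEdge.vertex h = HalfEdge.vertex h') : D.component h = D.component h' := by
  rw [Diagram.component, e, Diagram.component]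

theorem Diagram.component_edge (D : Diagram t u) (h : HalfEdge t u) :
    D.component (D.edge h) = D.component h := by
  refine SimpleGraph.ConnectedComponent.sound ?_
  by_cases e : HalfEdge.vertex (D.edge h) = HalfEdge.vertex h
  · rw [e]
  · exact SimpleGraph.Adj.reachable ((SimpleGraph.fromRel_adj _ _ _).2
      ⟨e, .inr ⟨h, rfl, rfl⟩⟩)

theorem Diagram.component_boundaryPerm (D : Diagram t u) (ε : Fin t → Bool) (h : HalfEdge t u) :
    D.component (D.boundaryPerm ε h) = D.component h := by
  rw [Diagram.boundaryPerm, Equiv.Perm.mul_apply, D.edgePerm_apply, D.component_edge]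
  refine D.component_eq_of_vertex ?_
  rcases h with ⟨v, k⟩ | l <;> simp [flagRelabel, HalfEdge.vertex]

/-- The number of boundary components of a ribbon graph with `k` connected components is at most
`2 * k - χ`, where `χ` is the Euler characteristic of the graph. -/
theorem Diagram.cycleCount_boundaryPerm_le (D : Diagram t u) (ε : Fin t → Bool) {n : ℕ}
    (hn : t + u = 2 * n) :
    cycleCount (D.boundaryPerm ε) + u ≤ n + 2 * (Set.range D.component).ncard := by
  obtain ⟨color, h1, h2, h3⟩ := D.genusBound_vertexTurn ε
  have h4 := D.card_le_two_mul_cycleCount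
  have hturn : ∀ v k, color (Sum.inl (v, k)) = color (Sum.inl (v, 0)) := by
    have hb : ∀ (b : Bool) (k : Fin 3), k = 0 ∨ vertexTurn b 0 = k ∨ vertexTurn b k = 0 := by
      decide
    intro v k
    rcases hb (ε v) k with h | h | h
    · rw [h]
    · rw [← h]; exact h2 (Sum.inl (v, 0))
    · rw [← h]; exact (h2 (Sum.inl (v, k))).symm
  -- `color` factors through the connected components.
  set f : Fin t ⊕ Fin u → _ := Sum.elim (fun v => color (Sum.inl (v, 0)))
    (fun j => color (Sum.inr j))
    with hf
  have hfv : ∀ h, f (HalfEdge.vertex h) = color h := by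
    rintro (⟨v, k⟩ | l)
    · exact (hturn v k).symm
    · rfl
  have hfe : ∀ h, f (HalfEdge.vertex h) = f (HalfEdge.vertex (D.edge h)) := fun h => by
    rw [hfv, hfv, h1]
  have hrange : (Set.range color).ncard ≤ (Set.range D.component).ncard := by
    have : Set.range color ⊆ (fun c : (flagGraph D.edge).ConnectedComponent =>
        SimpleGraph.ConnectedComponent.lift f
          (fun _ _ w _ => D.eq_of_reachable hfe w.reachable) c) '' Set.range D.component := by
      rintro _ ⟨h, rfl⟩
      exact ⟨_, ⟨h, rfl⟩, hfv h⟩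
    exact (Set.ncard_le_ncard this ((Set.finite_range _).image _)).trans
      (Set.ncard_image_le (Set.finite_range _))
  change cycleCount (D.edgePerm * flagRelabel 1 (fun v => vertexTurn (ε v)) 1) + u ≤ _
  omega

end Genus

/-! ### Vanishing of weights -/

section Vanishing

/-- The permutations `τ` and `τ'` describe the two resolutions of a trivalent vertex with a leg `a`:
they differ only in the strand, the one arriving at `f₂` or the one arriving at `f₁`, into which the
segment `a → f₀` is inserted. If `i` is constant along `τ` in the colour of `a`, except possibly at
`a`, then exchanging the values of the two strands outside `a` and `f₀` gives an index which is
constant along `τ'` in the same sense. -/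
theorem constant_off_leg {ι κ α : Type*} [Fintype ι] [DecidableEq ι] [DecidableEq κ] [DecidableEq α]
    {τ τ' : Equiv.Perm ι} {color : ι → κ} (hc : ∀ x, color (τ x) = color x)
    {a f₀ f₁ f₂ : ι} (ha0 : τ a = f₀) (ha2 : τ f₂ = a) (ha1 : τ' f₁ = a)
    (h0 : τ f₀ = τ' f₂) (h1 : τ f₁ = τ' f₀) (hoff : ∀ x, x ≠ f₀ → x ≠ f₁ → x ≠ f₂ → τ x = τ' x)
    (ha : a ≠ f₀) (h01 : f₀ ≠ f₁) (h02 : f₀ ≠ f₂) (h12 : f₁ ≠ f₂) (ha1' : a ≠ f₁) (ha2' : a ≠ f₂)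
    (hc1 : color f₁ = color a) {i i' : ι → α}
    (hi' : ∀ x, i' x = if color x = color a ∧ x ≠ a ∧ x ≠ f₀ then
      Equiv.swap (i f₁) (i f₂) (i x) else i x)
    (hi : ∀ x, color x = color a → x ≠ a → i x = i (τ x)) :
    ∀ x, color x = color a → x ≠ a → i' x = i' (τ' x) := by
  have hc0 : color f₀ = color a := by rw [← ha0, hc]
  have hc2 : color f₂ = color a := by rw [← ha2, hc]
  have hms := sum_exceptional hc (color a) {a} (by simp) i
    (fun x hx hxa => hi x hx (by simpa using hxa))
  rw [Finset.sum_singleton, Finset.sum_singleton, Multiset.singleton_inj, ha0] at hms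
  have e2 : i f₂ = i a := by rw [hi f₂ hc2 ha2'.symm, ha2]
  have eP : i (τ f₀) = i a := by rw [← hi f₀ hc0 ha.symm, hms]
  have eQ : i (τ f₁) = i f₁ := (hi f₁ hc1 ha1'.symm).symm
  have hin : ∀ x, color x = color a → x ≠ a → x ≠ f₀ →
      i' x = Equiv.swap (i f₁) (i f₂) (i x) := fun x h h' h'' => by rw [hi', if_pos ⟨h, h', h''⟩]
  have ia : i' a = i a := by rw [hi', if_neg (by simp)]
  have i0 : i' f₀ = i a := by rw [hi', if_neg (by simp), hms]
  -- The points `τ x` with `x ≠ a`, `x ≠ f₂` are neither `f₀` nor `a`.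
  have hne : ∀ x, x ≠ a → x ≠ f₂ → τ x ≠ a ∧ τ x ≠ f₀ := by
    intro x h h'
    rw [← ha0, ← ha2]
    exact ⟨fun e => h' (τ.injective (by rw [e, ha2])),
      fun e => h (τ.injective (by rw [e, ha2]))⟩
  have iP : i' (τ f₀) = i f₁ := by
    rw [hin _ (by rw [hc, hc0]) (hne f₀ ha.symm h02).1 (hne f₀ ha.symm h02).2, eP, ← e2,
      Equiv.swap_apply_right]
  have iQ : i' (τ f₁) = i f₂ := by
    rw [hin _ (by rw [hc, hc1]) (hne f₁ ha1'.symm h12).1 (hne f₁ ha1'.symm h12).2, eQ,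
      Equiv.swap_apply_left]
  intro x hx hxa
  by_cases hx0 : x = f₀
  · rw [hx0, ← h1, iQ, i0, e2]
  by_cases hx1 : x = f₁
  · rw [hx1, ha1, ia, hin _ hc1 ha1'.symm h01.symm, Equiv.swap_apply_left, e2]
  by_cases hx2 : x = f₂
  · rw [hx2, ← h0, iP, hin _ hc2 ha2'.symm h02.symm, Equiv.swap_apply_right]
  rw [← hoff x hx0 hx1 hx2, hin x hx hxa hx0, hin _ (by rw [hc, hx]) (hne x hxa hx2).1
    (hne x hxa hx2).2, hi x hx hxa]

/-- If `a` is the only letter of its colour, the word sum does not depend on the strand into which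
the segment `a → f₀` is inserted. -/
theorem wordSum_eq_of_single_leg {ι κ : Type*} [Fintype ι] [DecidableEq ι]
    {N : ℕ} {l : List ι} (hl : ∀ x, x ∈ l) {S : Finset ι}
    {τ τ' : Equiv.Perm ι} {color : ι → κ} (hc : ∀ x, color (τ x) = color x)
    (hc' : ∀ x, color (τ' x) = color x)
    {a f₀ f₁ f₂ : ι} (ha0 : τ a = f₀) (ha0' : τ' a = f₀) (ha2 : τ f₂ = a) (ha1 : τ' f₁ = a)
    (h0 : τ f₀ = τ' f₂) (h1 : τ f₁ = τ' f₀) (hoff : ∀ x, x ≠ f₀ → x ≠ f₁ → x ≠ f₂ → τ x = τ' x)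
    (ha : a ≠ f₀) (h01 : f₀ ≠ f₁) (h02 : f₀ ≠ f₂) (h12 : f₁ ≠ f₂) (ha1' : a ≠ f₁) (ha2' : a ≠ f₂)
    (hS : ∀ x ∈ S, color x = color a → x = a) :
    wordSum N l S τ = wordSum N l S τ' := by
  classical
  have hc0 : color f₀ = color a := by rw [← ha0, hc]
  have hc1 : color f₁ = color a := by rw [← ha1, hc']
  have hc2 : color f₂ = color a := by rw [← ha2, hc]
  set Ψ : (ι → Fin N) → ι → Fin N := fun i x =>
    if color x = color a ∧ x ≠ a ∧ x ≠ f₀ then Equiv.swap (i f₁) (i f₂) (i x) else i x with hΨ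
  have hΨ1 : ∀ i, Ψ i f₁ = i f₂ := fun i => by simp [hΨ, hc1, ha1'.symm, h01.symm]
  have hΨ2 : ∀ i, Ψ i f₂ = i f₁ := fun i => by simp [hΨ, hc2, ha2'.symm, h02.symm]
  have hinv : Function.Involutive Ψ := by
    intro i
    funext x
    have h : Ψ (Ψ i) x = if color x = color a ∧ x ≠ a ∧ x ≠ f₀ then
        Equiv.swap (Ψ i f₁) (Ψ i f₂) (Ψ i x) else Ψ i x := rfl
    rw [h, hΨ1, hΨ2]
    by_cases hx : color x = color a ∧ x ≠ a ∧ x ≠ f₀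
    · have h' : Ψ i x = Equiv.swap (i f₁) (i f₂) (i x) := if_pos hx
      rw [if_pos hx, h', Equiv.swap_comm, Equiv.swap_apply_self]
    · rw [if_neg hx]
      exact if_neg hx
  have hsupp : ∀ i, (∀ x, color x = color a → x ≠ a → i x = i (τ x)) ↔
      (∀ x, color x = color a → x ≠ a → Ψ i x = Ψ i (τ' x)) := by
    intro i
    constructor
    · exact constant_off_leg hc ha0 ha2 ha1 h0 h1 hoff ha h01 h02 h12 ha1' ha2' hc1
        fun x => rfl
    · refine constant_off_leg hc' ha0' ha1 ha2 h1.symm h0.symm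
        (fun x e0 e1 e2 => (hoff x e0 e2 e1).symm) ha h02 h01 h12.symm ha2' ha1' hc2 fun x => ?_
      rw [Equiv.swap_comm]
      exact congrFun (hinv i).symm x
  unfold wordSum
  refine Fintype.sum_equiv hinv.toPerm _ _ fun i => ?_
  rw [Function.Involutive.coe_toPerm]
  by_cases hi : ∀ x, color x = color a → x ≠ a → i x = i (τ x)
  · congr 1
    refine List.map_congr_left fun x _ => ?_
    by_cases hx : color x = color a
    · by_cases hxa : x = a
      · rw [hxa, ha0, ha0']
        simp [hΨ]
      · have hxS : x ∉ S := fun h => hxa (hS x h hx)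
        rw [letterMatrix_of_notMem hxS, letterMatrix_of_notMem hxS, if_pos (hi x hx hxa),
          if_pos ((hsupp i).1 hi x hx hxa)]
    · have hx' : τ x = τ' x := hoff x (fun e => hx (e ▸ hc0)) (fun e => hx (e ▸ hc1))
        (fun e => hx (e ▸ hc2))
      simp [hΨ, hx, hc', hx']
  · have hi' := (not_congr (hsupp i)).1 hi
    push Not at hi hi'
    obtain ⟨x, hx, hxa, hne⟩ := hi
    obtain ⟨y, hy, hya, hne'⟩ := hi'
    rw [word_eq_zero (hl x) (fun h => hxa (hS x h hx)) hne,
      word_eq_zero (hl y) (fun h => hya (hS y h hy)) hne']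

variable {t u : ℕ}

theorem Diagram.HasTrivalent.exists_edge_inr {D : Diagram t u} (hD : D.HasTrivalent) (j : Fin u) :
    ∃ v k, D.edge (Sum.inr j) = Sum.inl (v, k) := by
  rcases he : D.edge (Sum.inr j) with ⟨v, k⟩ | j'
  · exact ⟨v, k, rfl⟩
  -- Otherwise the component consists of one edge with two univalent ends.
  exfalso
  have he' : D.edge (Sum.inr j') = Sum.inr j := by rw [← he, D.edge_edge]
  obtain ⟨v, hv⟩ := hD (Sum.inr j)
  have := D.eq_of_reachable (f := fun p => p = Sum.inr j ∨ p = Sum.inr j') (fun h => ?_) hv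
  · simp at this
  · have hv : ∀ h i, HalfEdge.vertex h = (Sum.inr i : Fin t ⊕ Fin u) ↔ h = Sum.inr i := by
      rintro (⟨v, k⟩ | l) i <;> simp [HalfEdge.vertex]
    simp only [hv, eq_iff_iff]
    have hswap : ∀ x y, D.edge x = y ↔ x = D.edge y := fun x y =>
      ⟨fun e => by rw [← e, D.edge_edge], fun e => by rw [e, D.edge_edge]⟩
    rw [hswap, hswap, he, he', or_comm]

/-- If two legs end at the same trivalent vertex, exchanging them is an automorphism which reverses
the orientation of this vertex. -/
theorem Diagram.weight_eq_zero_of_two_legs (D : Diagram t u) (N : ℕ) {j j' : Fin u} (hj : j ≠ j')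
    {v : Fin t} {k k' : Fin 3} (h : D.edge (Sum.inr j) = Sum.inl (v, k))
    (h' : D.edge (Sum.inr j') = Sum.inl (v, k')) : D.weight N = 0 := by
  have hk : k ≠ k' := by
    rintro rfl
    have := congrArg D.edge (h.trans h'.symm)
    rw [D.edge_edge, D.edge_edge] at this
    exact hj (Sum.inr_injective this)
  set s : Fin t → Equiv.Perm (Fin 3) := Function.update 1 v (Equiv.swap k k') with hs
  have hσ : (flagRelabel 1 s (Equiv.swap j j') : Equiv.Perm (HalfEdge t u)) =
      Equiv.swap (Sum.inl (v, k)) (Sum.inl (v, k')) * Equiv.swap (Sum.inr j) (Sum.inr j') := by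
    ext1 x
    rcases x with ⟨w, m⟩ | l
    · rw [Equiv.Perm.mul_apply, Equiv.swap_apply_of_ne_of_ne (a := Sum.inr j) (by simp) (by simp)]
      by_cases hw : w = v
      · subst hw
        by_cases hi : m = k
        · subst hi
          simp [flagRelabel, hs]
        · by_cases hj : m = k'
          · subst hj
            simp [flagRelabel, hs]
          · simp [flagRelabel, hs, Equiv.swap_apply_of_ne_of_ne, hi, hj]
      · simp [flagRelabel, hs, Equiv.swap_apply_of_ne_of_ne, hw]
    · by_cases hi : l = j
      · subst hi
        simp [flagRelabel, Equiv.swap_apply_of_ne_of_ne]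
      · by_cases hj : l = j'
        · subst hj
          simp [flagRelabel, Equiv.swap_apply_of_ne_of_ne]
        · simp [flagRelabel, Equiv.swap_apply_of_ne_of_ne, hi, hj]
  have hcomm : ∀ x, D.edge (flagRelabel 1 s (Equiv.swap j j') x) =
      flagRelabel 1 s (Equiv.swap j j') (D.edge x) := by
    have hr : (Equiv.swap (Sum.inr j) (Sum.inr j') : Equiv.Perm (HalfEdge t u)) * D.edgePerm =
        D.edgePerm * Equiv.swap (Sum.inl (v, k)) (Sum.inl (v, k')) := by
      rw [Equiv.mul_swap_eq_swap_mul, D.edgePerm_apply, D.edgePerm_apply, ← h, ← h', D.edge_edge,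
        D.edge_edge]
    have hl : D.edgePerm * Equiv.swap (Sum.inr j) (Sum.inr j') =
        Equiv.swap (Sum.inl (v, k)) (Sum.inl (v, k')) * D.edgePerm := by
      rw [Equiv.mul_swap_eq_swap_mul, D.edgePerm_apply, D.edgePerm_apply, h, h']
    have hd : Commute (Equiv.swap (Sum.inl (v, k)) (Sum.inl (v, k')) : Equiv.Perm (HalfEdge t u))
        (Equiv.swap (Sum.inr j) (Sum.inr j')) := by
      refine (Equiv.Perm.disjoint_iff_eq_or_eq.2 fun x => ?_).commute
      rcases x with x | x
      · exact .inr (Equiv.swap_apply_of_ne_of_ne (by simp) (by simp))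
      · exact .inl (Equiv.swap_apply_of_ne_of_ne (by simp) (by simp))
    have : D.edgePerm * flagRelabel 1 s (Equiv.swap j j') =
        flagRelabel 1 s (Equiv.swap j j') * D.edgePerm := by
      rw [hσ, mul_assoc, hr, ← mul_assoc, ← mul_assoc, ← hl, mul_assoc, hd.eq, mul_assoc]
    exact fun x => DFunLike.congr_fun this x
  have hw : D.weight N = (∏ w, ((Equiv.Perm.sign (s w) : ℤ) : ℂ)) • D.weight N := by
    conv_rhs => rw [D.weight_of_conj D N _ hcomm, Finset.smul_sum]
    refine Finset.sum_congr rfl fun l _ => ?_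
    rw [← labelWeight_relabel, Function.comp_assoc, Equiv.symm_comp_self, Function.comp_id]
  have hsign : (∏ w, ((Equiv.Perm.sign (s w) : ℤ) : ℂ)) = -1 := by
    rw [Finset.prod_eq_single v]
    · simp [hs, Equiv.Perm.sign_swap hk]
    · intro w _ hw
      simp [hs, Function.update_of_ne hw]
    · simp
  rw [hsign, neg_one_smul] at hw
  have h2 : (2 : ℂ) • D.weight N = 0 := by
    rw [two_smul]
    nth_rewrite 1 [hw]
    exact neg_add_cancel _
  exact (smul_eq_zero.1 h2).resolve_left two_ne_zero

/-- Each leg ends at a trivalent vertex, and if there are more legs than trivalent vertices, two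
legs end at the same one. -/
theorem Diagram.HasTrivalent.weight_eq_zero {D : Diagram t u} (hD : D.HasTrivalent) (htu : t < u)
    (N : ℕ) : D.weight N = 0 := by
  choose v k hvk using hD.exists_edge_inr
  obtain ⟨j, j', hj, hv⟩ := Fintype.exists_ne_map_eq_of_card_lt v (by simpa using htu)
  exact D.weight_eq_zero_of_two_legs N hj (hvk j) (hv ▸ hvk j')

theorem Diagram.wordSum_flip (D : Diagram t u) (N : ℕ) {j : Fin u} {v : Fin t} {k : Fin 3}
    (h : D.edge (Sum.inr j) = Sum.inl (v, k))
    (hj : ∀ j', D.component (Sum.inr j') = D.component (Sum.inr j) → j' = j)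
    {l : List (HalfEdge t u)} (hl : ∀ x, x ∈ l) {ε ε' : Fin t → Bool} (hε : ε v = false)
    (hε' : ε' v = true) (hεε' : ∀ w, w ≠ v → ε w = ε' w) :
    wordSum N l (legSet t u) (D.boundaryPerm ε) = wordSum N l (legSet t u) (D.boundaryPerm ε') := by
  have hj' : D.edge (Sum.inl (v, k)) = Sum.inr j := by rw [← h, D.edge_edge]
  have hk1 : ∀ k : Fin 3, k ≠ k + 1 ∧ k ≠ k + 2 ∧ k + 1 ≠ k + 2 ∧ k + 1 + 1 = k + 2 ∧
      k + 1 + 2 = k ∧ k + 2 + 1 = k ∧ k + 2 + 2 = k + 1 := by decide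
  obtain ⟨d01, d02, d12, e11, e12, e21, e22⟩ := hk1 k
  have hcover : ∀ k m : Fin 3, m = k ∨ m = k + 1 ∨ m = k + 2 := by decide
  have hf : ∀ m, D.boundaryPerm ε (Sum.inl (v, m)) = D.edge (Sum.inl (v, m + 1)) := fun m => by
    rw [D.boundaryPerm_inl, hε]; rfl
  have ht : ∀ m, D.boundaryPerm ε' (Sum.inl (v, m)) = D.edge (Sum.inl (v, m + 2)) := fun m => by
    rw [D.boundaryPerm_inl, hε']; rfl
  refine wordSum_eq_of_single_leg hl (D.component_boundaryPerm ε) (D.component_boundaryPerm ε')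
    (a := Sum.inr j) (f₀ := Sum.inl (v, k)) (f₁ := Sum.inl (v, k + 1)) (f₂ := Sum.inl (v, k + 2))
    (by rw [D.boundaryPerm_inr, h]) (by rw [D.boundaryPerm_inr, h]) (by rw [hf, e21, hj'])
    (by rw [ht, e12, hj']) (by rw [hf, ht, e22]) (by rw [hf, ht, e11]) ?_ (by simp)
    (by simp) (by simp) (by simp) (by simp) (by simp)
    ?_
  · rintro (⟨w, m⟩ | i) h0 h1 h2
    · have hw : w ≠ v := by
        rintro rfl
        rcases hcover k m with rfl | rfl | rfl
        exacts [h0 rfl, h1 rfl, h2 rfl]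
      rw [D.boundaryPerm_inl, D.boundaryPerm_inl, hεε' w hw]
    · rfl
  · rintro (x | i) hx hc
    · exact absurd hx (inl_notMem_legSet x)
    · rw [hj i hc]

/-- If a connected component has only one leg, the two resolutions of the vertex at this leg
contribute with opposite signs. -/
theorem Diagram.HasTrivalent.weight_eq_zero_of_single_leg {D : Diagram t u} (hD : D.HasTrivalent)
    (N : ℕ) {j : Fin u} (hj : ∀ j', D.component (Sum.inr j') = D.component (Sum.inr j) → j' = j) :
    D.weight N = 0 := by
  obtain ⟨v, k, h⟩ := hD.exists_edge_inr j
  have hflip : ∀ ε l, (∀ x, x ∈ l) → wordSum N l (legSet t u) (D.boundaryPerm ε) =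
      wordSum N l (legSet t u) (D.boundaryPerm (Function.update ε v (!ε v))) := by
    intro ε l hl
    cases hb : ε v
    · exact D.wordSum_flip N h hj hl hb (by simp) fun w hw => by
        rw [Function.update_of_ne hw]
    · exact (D.wordSum_flip N h hj hl (by simp) hb fun w hw => by
        rw [Function.update_of_ne hw]).symm
  rw [D.weight_eq_sum]
  -- Pair each resolution with the one which differs from it at `v` only.
  refine Finset.sum_involution (fun ε _ => Function.update ε v (!ε v)) ?_ ?_ ?_ ?_
  · intro ε _
    have hsgn : ∏ w, turnSign (Function.update ε v (!ε v) w) = -∏ w, turnSign (ε w) := by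
      rw [← Finset.mul_prod_erase _ _ (Finset.mem_univ v),
        ← Finset.mul_prod_erase _ (fun w => turnSign (ε w)) (Finset.mem_univ v),
        Function.update_self, Finset.prod_congr rfl fun w hw => by
          rw [Function.update_of_ne (Finset.ne_of_mem_erase hw)], ← neg_mul]
      congr 1
      cases ε v <;> simp [turnSign]
    rw [hsgn, neg_smul, Finset.sum_congr rfl fun π _ => hflip ε _ (mem_flagList π), add_neg_cancel]
  · intro ε _ _ e
    have := congrFun e v
    simp at this
  · simp
  · intro ε _
    simp

end Vanishing

/-! ### The weights as polynomials in the Casimir elements -/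

section Polynomials

theorem Diagram.HasTrivalent.weight_mem_casimirSpan {t u n : ℕ} {D : Diagram t u}
    (hD : D.HasTrivalent) (hn : 1 ≤ n) (htu : t + u = 2 * n) :
    (fun N => D.weight N) ∈ casimirSpan (min u n) n := by
  by_cases hu : t < u
  · simp only [hD.weight_eq_zero hu]
    exact Submodule.zero_mem _
  by_cases hsingle : ∃ j : Fin u, ∀ j', D.component (Sum.inr j') = D.component (Sum.inr j) → j' = j
  · obtain ⟨j, hj⟩ := hsingle
    simp only [hD.weight_eq_zero_of_single_leg _ hj]
    exact Submodule.zero_mem _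
  push Not at hsingle
  have htwo : TwoOfEachColor (legSet t u) D.component := by
    intro x
    obtain ⟨j, hj⟩ := D.exists_leg (HalfEdge.vertex x)
    have hjx : D.component (Sum.inr j) = D.component x :=
      SimpleGraph.ConnectedComponent.sound hj.symm
    obtain ⟨j', hj', hne⟩ := hsingle j
    exact ⟨Sum.inr j, inr_mem_legSet j, Sum.inr j', inr_mem_legSet j',
      fun e => hne (Sum.inr_injective e).symm, hjx, hj'.trans hjx⟩
  have : Nonempty (HalfEdge t u) := by
    have ht : 0 < t := by omega
    exact ⟨Sum.inl (⟨0, ht⟩, 0)⟩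
  have hword : ∀ (ε : Fin t → Bool) (π : Equiv.Perm (Fin u)),
      (fun N => wordSum N (flagList t π) (legSet t u) (D.boundaryPerm ε)) ∈
        casimirSpan (min u n) n := fun ε π =>
    wordSum_mem_casimirSpan _ _ _ (legSet t u) (D.boundaryPerm ε) D.component _ rfl
      (by rw [card_legSet]; omega) (D.component_boundaryPerm ε) htwo
      (by rw [card_legSet]; exact D.cycleCount_boundaryPerm_le ε htu)
      (nodup_flagList π) (mem_flagList π)
  have heq : (fun N => D.weight N) = ∑ ε : Fin t → Bool, (∏ v, turnSign (ε v)) •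
      ((u.factorial : ℂ)⁻¹ • ∑ π : Equiv.Perm (Fin u), fun N =>
        wordSum N (flagList t π) (legSet t u) (D.boundaryPerm ε)) := by
    funext N
    simp only [D.weight_eq_sum, Finset.sum_apply, Pi.smul_apply]
  rw [heq]
  exact Submodule.sum_mem _ fun ε _ => Submodule.smul_mem _ _ (Submodule.smul_mem _ _
    (Submodule.sum_mem _ fun π _ => hword ε π))

theorem exists_polynomial_of_mem_casimirSpan {w r : ℕ} {x : (N : ℕ) → GlU N}
    (hx : x ∈ casimirSpan w r) :
    ∃ P : MvPolynomial ℕ ℂ, (∀ m ∈ P.support, (m.sum fun j e => j * e) ≤ w ∧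
      (m.sum fun _ e => e) ≤ r) ∧
      ∀ N : ℕ, x N = (MvPolynomial.aeval (casimir N) P : Subalgebra.center ℂ (GlU N)) := by
  classical
  induction hx using Submodule.span_induction with
  | mem x hx =>
    obtain ⟨s, ⟨-, hs2, hs3⟩, rfl⟩ := hx
    refine ⟨MvPolynomial.monomial (Multiset.toFinsupp s) 1, fun m hm => ?_, fun N => ?_⟩
    · rw [MvPolynomial.support_monomial, if_neg one_ne_zero, Finset.mem_singleton] at hm
      subst hm
      refine ⟨le_trans (le_of_eq ?_) hs2, le_trans (le_of_eq ?_) hs3⟩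
      · rw [Finset.sum_multiset_count, Finsupp.sum, Multiset.toFinsupp_support]
        exact Finset.sum_congr rfl fun j _ => by
          rw [Multiset.toFinsupp_apply, smul_eq_mul, mul_comm]
      · rw [Finsupp.sum, Multiset.toFinsupp_support, ← Multiset.toFinset_sum_count_eq]
        exact Finset.sum_congr rfl fun j _ => by rw [Multiset.toFinsupp_apply]
    · rw [casimirFamily, MvPolynomial.aeval_monomial, map_one, one_mul,
        Finset.prod_multiset_map_count, Finsupp.prod, Multiset.toFinsupp_support]
      congr 1
  | zero => exact ⟨0, by simp, by simp⟩
  | add x y _ _ ihx ihy =>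
    obtain ⟨P, hP, hP'⟩ := ihx
    obtain ⟨Q, hQ, hQ'⟩ := ihy
    refine ⟨P + Q, fun m hm => ?_, fun N => ?_⟩
    · rcases Finset.mem_union.1 (MvPolynomial.support_add hm) with h | h
      exacts [hP m h, hQ m h]
    · rw [Pi.add_apply, hP', hQ', map_add, AddMemClass.coe_add]
  | smul c x _ ihx =>
    obtain ⟨P, hP, hP'⟩ := ihx
    refine ⟨c • P, fun m hm => hP m (MvPolynomial.support_smul hm), fun N => ?_⟩
    rw [Pi.smul_apply, hP', map_smul, SetLike.val_smul]

theorem glWeightSystem_cls {t u : ℕ} (D : Diagram t u) (N : ℕ) :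
    glWeightSystem N D.cls = D.weight N := by
  rw [← freeWeight_gen]
  exact Submodule.liftQ_apply _ _ _

end Polynomials

/-! ### Counting the products of Casimir elements -/

section Counting

/-- A partition of a number between `1` and `n` is completed to a partition of `n` by parts `1`. -/
def padPartition {n : ℕ} (s : Multiset ℕ) (h : s.sum ≤ n) : Nat.Partition n where
  parts := s.filter (0 < ·) + Multiset.replicate (n - s.sum) 1
  parts_pos := by
    intro i hi
    rcases Multiset.mem_add.1 hi with hi | hi
    · exact (Multiset.mem_filter.1 hi).2
    · rw [Multiset.eq_of_mem_replicate hi]; exact one_pos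
  parts_sum := by
    have h1 : (s.filter (0 < ·)).sum = s.sum := by
      conv_rhs => rw [← Multiset.filter_add_not (0 < ·) s, Multiset.sum_add]
      rw [Multiset.sum_eq_zero (s := s.filter fun a => ¬ 0 < a), add_zero]
      intro x hx
      exact Nat.eq_zero_of_not_pos (Multiset.mem_filter.1 hx).2
    rw [Multiset.sum_add, h1, Multiset.sum_replicate, smul_eq_mul, mul_one]
    omega

theorem count_zero_lt {n : ℕ} {s : Multiset ℕ} (h1 : 1 ≤ s.sum) (h2 : s.card ≤ n) :
    s.count 0 < n := by
  refine lt_of_lt_of_le ?_ h2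
  rw [lt_iff_le_and_ne]
  refine ⟨Multiset.count_le_card 0 s, fun h => ?_⟩
  have := Multiset.count_eq_card.1 h
  rw [Multiset.sum_eq_zero fun x hx => (this x hx).symm] at h1
  omega

/-- The product is determined by the sum of its indices, by the number of factors `c_0`, and by the
padded partition formed by the other indices. -/
theorem encard_casimir_indices_le (n : ℕ) :
    {s : Multiset ℕ | 1 ≤ s.sum ∧ s.sum ≤ n ∧ s.card ≤ n}.encard ≤
      (n ^ 2 * Fintype.card (Nat.Partition n) : ℕ) := by
  set T := {s : Multiset ℕ | 1 ≤ s.sum ∧ s.sum ≤ n ∧ s.card ≤ n} with hT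
  let f : T → Fin n × Fin n × Nat.Partition n := fun s =>
    (⟨s.1.sum - 1, by have := s.2.1; have := s.2.2.1; omega⟩,
      ⟨s.1.count 0, count_zero_lt s.2.1 s.2.2.2⟩, padPartition s.1 s.2.2.1)
  have hf : Function.Injective f := by
    rintro ⟨s, hs⟩ ⟨s', hs'⟩ h
    simp only [f, Prod.mk.injEq, Fin.mk.injEq] at h
    obtain ⟨h1, h2, h3⟩ := h
    have hsum : s.sum = s'.sum := by have := hs.1; have := hs'.1; omega
    have h4 := congrArg Nat.Partition.parts h3
    simp only [padPartition, hsum, add_left_inj] at h4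
    refine Subtype.ext (Multiset.ext.2 fun j => ?_)
    rcases Nat.eq_zero_or_pos j with rfl | hj
    · exact h2
    · have h5 := congrArg (Multiset.count j) h4
      rwa [Multiset.count_filter_of_pos (p := (0 < ·)) hj,
        Multiset.count_filter_of_pos (p := (0 < ·)) hj] at h5
  have h1 := ENat.card_le_card_of_injective hf
  have h2 : ENat.card (Fin n × Fin n × Nat.Partition n) =
      (n ^ 2 * Fintype.card (Nat.Partition n) : ℕ) := by
    rw [ENat.card_eq_coe_fintype_card]
    simp [pow_two, mul_assoc]
  rw [Set.encard, ← h2]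
  exact h1

theorem rank_casimirSpan_le (n : ℕ) :
    Module.rank ℂ (casimirSpan n n) ≤ (n ^ 2 * Fintype.card (Nat.Partition n) : ℕ) := by
  refine (rank_span_le _).trans ?_
  have h1 := (Set.encard_image_le casimirFamily _).trans (encard_casimir_indices_le n)
  rw [← Set.toENat_cardinalMk] at h1
  exact (Cardinal.toENat_le_natCast).1 h1

theorem map_reducedSpace_le (n : ℕ) (hn : 1 ≤ n) :
    (reducedSpace n).map glWeightSystemFamily ≤ casimirSpan n n := by
  rw [reducedSpace, Submodule.map_span, Submodule.span_le]
  rintro _ ⟨_, ⟨t, u, D, htu, hD, rfl⟩, rfl⟩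
  have h1 : glWeightSystemFamily D.cls = fun N => D.weight N :=
    funext fun N => glWeightSystem_cls D N
  have h2 : casimirSpan (min u n) n ≤ casimirSpan n n := Submodule.span_mono
    (Set.image_mono fun s hs => ⟨hs.1, hs.2.1.trans (min_le_right _ _), hs.2.2⟩)
  rw [h1]
  exact h2 (hD.weight_mem_casimirSpan hn htu)

end Counting

theorem mainTheorem5 (n : ℕ) (hn : 1 ≤ n) :
    (∀ (t u : ℕ) (D : Diagram t u), t + u = 2 * n → D.HasTrivalent →
      ∃ P : MvPolynomial ℕ ℂ,
        (∀ m ∈ P.support, (m.sum fun j e => j * e) ≤ u ∧ (m.sum fun j e => j * e) ≤ n ∧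
          (m.sum fun _ e => e) ≤ n) ∧
        ∀ N : ℕ, glWeightSystem N D.cls = (MvPolynomial.aeval (casimir N) P : GlU N)) ∧
    Module.rank ℂ ((reducedSpace n).map glWeightSystemFamily) ≤
      ((n ^ 2 * Fintype.card (Nat.Partition n) : ℕ) : Cardinal) ∧
    ∀ N : ℕ, Module.rank ℂ ((reducedSpace n).map (glWeightSystem N)) ≤
      ((n ^ 2 * Fintype.card (Nat.Partition n) : ℕ) : Cardinal) := by
  have hrank : Module.rank ℂ ((reducedSpace n).map glWeightSystemFamily) ≤
      ((n ^ 2 * Fintype.card (Nat.Partition n) : ℕ) : Cardinal) :=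
    (Submodule.rank_mono (map_reducedSpace_le n hn)).trans (rank_casimirSpan_le n)
  refine ⟨fun t u D htu hD => ?_, hrank, fun N => ?_⟩
  · obtain ⟨P, hP, hP'⟩ := exists_polynomial_of_mem_casimirSpan
      (hD.weight_mem_casimirSpan hn htu)
    refine ⟨P, fun m hm => ?_, fun N => ?_⟩
    · have := hP m hm
      exact ⟨this.1.trans (min_le_left _ _), this.1.trans (min_le_right _ _), this.2⟩
    · rw [glWeightSystem_cls]
      exact hP' N
  · have : (reducedSpace n).map (glWeightSystem N) =
        ((reducedSpace n).map glWeightSystemFamily).map (LinearMap.proj N) := by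
      rw [← Submodule.map_comp]
      rfl
    rw [this]
    exact (rank_map_le _ _).trans hrank
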